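/- **Setting.** Let $\eta=\mathrm{diag}(-1,1,1,1)$ be the Minkowski metric on $\mathbb R^{3,1}$, let $\epsilon^{IJKL}$ be totally antisymmetric with $\epsilon^{0123}=1$, indices being moved with $\eta$, and let $(\ast W)^{IJ}=\tfrac12\epsilon^{IJ}{}_{KL}W^{KL}$ and $(u\wedge v)^{IJ}=u^Iv^J-v^Iu^J$. Number the vertices of each oriented 4-simplex by $1,\dots,5$ compatibly with its orientation; let $l_P$ be the line from its barycenter to the barycenter of the 3-simplex opposite to $P$. Oriented wedges $s_{PQ}$ ($P\ne Q$) correspond to ordered pairs $(l_P,l_Q)$. The corner cell $c_T$ contains the four lines $l_P$ with $P\neq T$ and the wedges between them, and in it $\mathrm{sgn}(s_{PQ},s_{RS})=\epsilon^{PQRST}$. A discrete $B$ field assigns to every oriented wedge $s_{PQ}$ of every 4-simplex an element $B_{PQ}=-B_{QP}$ of $\mathfrak{so}(3,1)$, with components $B_{PQ}^{IJ}$. A discrete tetrad $e$ assigns a vector $e_P\in\mathbb R^{3,1}$ to every line $l_P$ of every 4-simplex. It is *oriented* if $\epsilon^{PQRST}\det(e_P,e_Q,e_R,e_S)>0$ in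 each corner cell $c_T$ whenever $P,Q,R,S,T$ are distinct, i.e. if $l_P\mapsto e_P$ respects orientations. Put $\langle B_s,B_{s'}\rangle=\epsilon_{IJKL}B_s^{IJ}B_{s'}^{KL}$ and $$\Sigma(c)=\sum_{\{s,s'\}}\mathrm{sgn}(s,s')\,\langle B_s,B_{s'}\rangle ,\qquad V(c)=4^4\cdot\tfrac1{12}\,\Sigma(c),$$ where the sum runs over the unordered pairs of oriented wedges of $c$ (twelve of which have nonzero sign). $B$ is *nondegenerate* if $V(c)\ne0$ for every corner cell $c$. **Theorem.** Let $B$ be a nondegenerate discrete $B$ field. There is an oriented tetrad $e$ with $B_{PQ}=\ast\, e_P\wedge e_Q$ for all wedges, unique up to sign (any tetrad $e'$ with $B_{PQ}=\ast\, e'_P\wedge e'_Q$ for all wedges equals $e$ or $-e$ in each 4-simplex), if and only if the following three conditions hold for every corner cell $c$: * (GG1) $\langle B_s,B_{s'}\rangle=\tfrac1{12}\,\mathrm{sgn}(s,s')\,\Sigma(c)$ for all oriented wedges $s,s'$ of $c$; * (GG2) $V(c)>0$; * (GG3) for $c=c_T$, the bilinear form on the lines of $c_T$ $$g_{QR}(c_T)=\frac1{12\,V(c_T)}\,f_{ijk}\,\epsilon^{ABCDT}B^i_{QA}B^j_{BC}B^k_{DR}\qquad(Q,R\ne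 T)$$ has the same signature as $\eta$, where $f_{ijk}$ are the structure constants of $\mathfrak{so}(3,1)$ with the last index lowered by the Killing form. -/

import Mathlib

open scoped Matrix

noncomputable section

namespace DiscreteGravity

attribute [local instance 100] LieRing.ofAssociativeRing

/-! ### Minkowski space and the Lie algebra `so(3,1)` -/

/-- Minkowski space `ℝ^{3,1}`; vectors have contravariant components `v^I`. -/
abbrev Mink : Type := Fin 4 → ℝ

/-- The Minkowski metric `η_{IJ} = diag(-1, 1, 1, 1)`. As a matrix it is its own inverse, so it also
represents `η^{IJ}`. -/
def eta : Matrix (Fin 4) (Fin 4) ℝ := Matrix.diagonal ![-1, 1, 1, 1]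

/-- The Lie algebra `so(3,1)`: the endomorphisms `X^I_J` of Minkowski space that are
skew-adjoint for `η`. -/
abbrev so31 : LieSubalgebra ℝ (Matrix (Fin 4) (Fin 4) ℝ) := skewAdjointMatricesLieSubalgebra eta

/-- The totally antisymmetric symbol on `n` letters, normalized by `ε (0, 1, …, n-1) = 1`: the
product over `a < b` of the signs of `i b - i a`. -/
def epsilon {n : ℕ} (i : Fin n → Fin n) : ℤ :=
  ∏ a, ∏ b ∈ Finset.Ioi a, Int.sign (((i b : ℕ) : ℤ) - ((i a : ℕ) : ℤ))

/-- `ε^{IJKL}`, normalized by `ε^{0123} = 1`. -/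
def epsUp (I J K L : Fin 4) : ℝ := (epsilon ![I, J, K, L] : ℝ)

/-- `ε_{IJKL}`, obtained from `ε^{IJKL}` by lowering the four indices with `η`. -/
def epsDown (I J K L : Fin 4) : ℝ :=
  ∑ A, ∑ B, ∑ C, ∑ D, eta I A * eta J B * eta K C * eta L D * epsUp A B C D

/-- The contravariant components `X^{IJ} = X^I_K η^{KJ}` of an element of `so(3,1)`. -/
def upper (X : so31) : Matrix (Fin 4) (Fin 4) ℝ := (X : Matrix (Fin 4) (Fin 4) ℝ) * eta

/-- The wedge product of two vectors, `(u ∧ v)^{IJ} = u^I v^J - v^I u^J`. -/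
def wedge (u v : Mink) : Matrix (Fin 4) (Fin 4) ℝ := fun I J => u I * v J - v I * u J

/-- The Hodge dual of a bivector, `(∗W)^{IJ} = ½ ε^{IJ}_{KL} W^{KL}`. -/
def hodge (W : Matrix (Fin 4) (Fin 4) ℝ) : Matrix (Fin 4) (Fin 4) ℝ := fun I J =>
  (1 / 2) * ∑ K, ∑ L, (∑ M, ∑ N, epsUp I J M N * eta M K * eta N L) * W K L

/-- `ε_{IJKL} X^{IJ} Y^{KL}`. -/
def epsPair (X Y : so31) : ℝ :=
  ∑ I, ∑ J, ∑ K, ∑ L, epsDown I J K L * upper X I J * upper Y K L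

/-- `f_{ijk} X^i Y^j Z^k`, where `f_{ij}^k` are the structure constants of `so(3,1)` and the last
index is lowered with the Killing form. -/
def structureForm (X Y Z : so31) : ℝ := killingForm ℝ so31 ⁅X, Y⁆ Z

/-! ### The cells and the fields

Every oriented 4-simplex carries a numbering of its vertices by `Fin 5`, compatible with the
orientation. The internal line `l_P` runs from the barycenter of the 4-simplex to the barycenter of
the 3-simplex opposite to the vertex `P`. The oriented wedge `s_{PQ}` is the ordered pair of the
distinct lines `l_P`, `l_Q`. The corner cell `c_T` of the vertex `T` contains the four lines `l_P`
with `P ≠ T` and the wedges between them. -/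

/-- `ε^{PQRST}`. It is `sgn(s_{PQ}, s_{RS})`, and the orientation of the ordered four-tuple of lines
`(l_P, l_Q, l_R, l_S)`, in the corner cell `c_T`. -/
def sgn (P Q R S T : Fin 5) : ℝ := (epsilon ![P, Q, R, S, T] : ℝ)

/-- A discrete `B` field on a collection `N` of 4-simplices: an element of `so(3,1)` for each
oriented wedge of each 4-simplex, changing sign with the orientation of the wedge. (Wedges `s_{PQ}`
have `P ≠ Q`; the value on the diagonal is `0` by antisymmetry.) -/
structure BField (N : Type*) where
  /-- `B_{PQ}` in the 4-simplex `ν`. -/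
  val : N → Fin 5 → Fin 5 → so31
  antisymm : ∀ ν P Q, val ν Q P = -val ν P Q

/-- A discrete tetrad field on a collection `N` of 4-simplices: a Minkowski vector `e_P` for each
internal line `l_P` of each 4-simplex. -/
abbrev Tetrad (N : Type*) : Type _ := N → Fin 5 → Mink

/-- The tetrad is (nondegenerate and) compatible with the orientation: in each corner cell `c_T`,
the assignment `l_P ↦ e_P` takes positively oriented four-tuples of lines to positively oriented
bases of Minkowski space, and negatively oriented ones to negatively oriented bases. -/
def Tetrad.Oriented {N : Type*} (e : Tetrad N) : Prop :=
  ∀ ν, ∀ P Q R S T : Fin 5, sgn P Q R S T ≠ 0 →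
    0 < sgn P Q R S T * Matrix.det (Matrix.of ![e ν P, e ν Q, e ν R, e ν S])

namespace BField

variable {N : Type*}

/-- `B_{PQ} = ∗ (e_P ∧ e_Q)` for all wedges. -/
def IsGeometric (B : BField N) (e : Tetrad N) : Prop :=
  ∀ ν, ∀ P Q : Fin 5, P ≠ Q → upper (B.val ν P Q) = hodge (wedge (e ν P) (e ν Q))

/-- The sum of `sgn(s, s') ε_{IJKL} B_s^{IJ} B_{s'}^{KL}` over the unordered pairs `{s, s'}` of
oriented wedges in the corner cell `c_T`. Twelve unordered pairs have nonzero sign; the sum over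
`A, B, C, D` runs through the corresponding 24 ordered pairs `(s_{AB}, s_{CD})`. -/
def cornerSum (B : BField N) (ν : N) (T : Fin 5) : ℝ :=
  (1 / 2) * ∑ P, ∑ Q, ∑ R, ∑ S, sgn P Q R S T * epsPair (B.val ν P Q) (B.val ν R S)

/-- The 4-volume of the corner cell `c_T`: `4^4` times the mean of
`sgn(s, s') ε_{IJKL} B_s^{IJ} B_{s'}^{KL}` over the twelve transversal pairs in `c_T`. When this
expression does not depend on the pair, its mean is the value at any transversal pair. -/
def volume (B : BField N) (ν : N) (T : Fin 5) : ℝ := 4 ^ 4 * ((1 / 12) * B.cornerSum ν T)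

/-- The field is nondegenerate when all corner cells have nonzero 4-volume. -/
def Nondegenerate (B : BField N) : Prop := ∀ ν T, B.volume ν T ≠ 0

/-- The quadratic condition in each corner cell `c_T`, for all oriented wedges `s_{PQ}`, `s_{RS}`
of `c_T`. -/
def GG1 (B : BField N) : Prop :=
  ∀ ν, ∀ T P Q R S : Fin 5, P ≠ T → Q ≠ T → R ≠ T → S ≠ T → P ≠ Q → R ≠ S →
    epsPair (B.val ν P Q) (B.val ν R S) - (1 / 12) * sgn P Q R S T * B.cornerSum ν T = 0

/-- Positivity of the 4-volume of each corner cell. -/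
def GG2 (B : BField N) : Prop := ∀ ν T, 0 < B.volume ν T

/-- The bilinear form of Urbantke type on the corner cell `c_T`, a matrix indexed by the four lines
of `c_T`:
`g_{QR}(c_T) = 1 / (12 V(c_T)) * f_{ijk} ε^{ABCDT} B^i_{QA} B^j_{BC} B^k_{DR}`. -/
def urbantke (B : BField N) (ν : N) (T : Fin 5) :
    Matrix {P : Fin 5 // P ≠ T} {P : Fin 5 // P ≠ T} ℝ :=
  fun Q R => 1 / (12 * B.volume ν T) *
    ∑ A, ∑ B', ∑ C, ∑ D, sgn A B' C D T *
      structureForm (B.val ν Q A) (B.val ν B' C) (B.val ν D R)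

/-- The form of Urbantke type has the signature of the Minkowski metric in each corner cell. -/
def GG3 (B : BField N) : Prop :=
  ∀ ν T,
    sigPos (B.urbantke ν T).toQuadraticForm' = sigPos eta.toQuadraticForm' ∧
    sigNeg (B.urbantke ν T).toQuadraticForm' = sigNeg eta.toQuadraticForm'

end BField

end DiscreteGravity

end

open scoped Matrix

noncomputable section

namespace DiscreteGravity

attribute [local instance 100] LieRing.ofAssociativeRing

/-! ### Bivectors as antisymmetric matrices -/

/-! The exterior product is a quadratic form of signature (3,3) on bivectors of ℝ⁴. (GG1) says that
the six bivectors of a corner cell pair like the `e_p ∧ e_q` of a frame, up to a common factor. In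
particular `B_01`, `B_02`, `B_03` span a maximal isotropic subspace, and these come in two families:
the bivectors divisible by a fixed vector and those annihilated by a fixed covector. In
`exists_common_kernel` the dichotomy comes from the Clifford relation `W Ṽ + V W̃ = -⟨W,V⟩ 1`: the
words `X₁ X̃₂ X₃` and `X̃₁ X₂ X̃₃` are the two candidate pure spinors, and a nonzero column is the
vector or covector sought. A common vector yields `B = ± e ∧ e` (`exists_frame`). The Hodge dual
exchanges the two families, so otherwise `B = ± ∗(e ∧ e)` (`exists_frame_or_hodge`).

The Urbantke form settles the four cases. It vanishes on `± e ∧ e`, and on `± ∗(e ∧ e)` it is `± 4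
det(e) / V` times the Gram matrix of `e`. Since (GG2) makes `det e` and `V` positive, (GG3) leaves
only `+ ∗(e ∧ e)`. For a geometric field the same identities give `Σ = 48 det(e)` and hence the
three conditions.

Three vectors of a frame are determined up to one common sign by their wedge products
(`eq_or_eq_neg_of_wedge_eq`), and two corner cells share three lines. Hence the corner frames can be
given matching signs and glued, and the result is unique up to sign in each 4-simplex. -/

/-- The antisymmetric matrix with prescribed entries above the diagonal. -/
def antisymm (a b c d e f : ℝ) : Matrix (Fin 4) (Fin 4) ℝ :=
  !![0, a, b, c; -a, 0, d, e; -b, -d, 0, f; -c, -e, -f, 0]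

theorem exists_eq_antisymm {W : Matrix (Fin 4) (Fin 4) ℝ} (h : Wᵀ = -W) :
    ∃ a b c d e f, W = antisymm a b c d e f := by
  have h' : ∀ i j, W j i = -W i j := fun i j => congrFun (congrFun h i) j
  refine ⟨W 0 1, W 0 2, W 0 3, W 1 2, W 1 3, W 2 3, ?_⟩
  have h0 : ∀ i, W i i = 0 := fun i => by linarith [h' i i]
  ext i j
  fin_cases i <;> fin_cases j <;> simp [antisymm, h0] <;> exact h' _ _

/-- The exterior product of two bivectors, as a multiple of the standard volume element. -/
def wedgePair (W V : Matrix (Fin 4) (Fin 4) ℝ) : ℝ :=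
  W 0 1 * V 2 3 + W 2 3 * V 0 1 - W 0 2 * V 1 3 - W 1 3 * V 0 2 + W 0 3 * V 1 2 + W 1 2 * V 0 3

/-- The two-form `½ ε_{IJKL} W^{KL}` dual to a bivector with respect to the standard volume. -/
def tilde (W : Matrix (Fin 4) (Fin 4) ℝ) : Matrix (Fin 4) (Fin 4) ℝ :=
  antisymm (W 2 3) (-W 1 3) (W 1 2) (W 0 3) (-W 0 2) (W 0 1)

theorem tilde_transpose (W : Matrix (Fin 4) (Fin 4) ℝ) : (tilde W)ᵀ = -tilde W := by
  ext i j
  fin_cases i <;> fin_cases j <;> simp [tilde, antisymm]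

theorem tilde_tilde {W : Matrix (Fin 4) (Fin 4) ℝ} (h : Wᵀ = -W) : tilde (tilde W) = W := by
  obtain ⟨a, b, c, d, e, f, rfl⟩ := exists_eq_antisymm h
  ext i j
  fin_cases i <;> fin_cases j <;> simp [tilde, antisymm]

theorem wedgePair_comm (W V : Matrix (Fin 4) (Fin 4) ℝ) : wedgePair W V = wedgePair V W := by
  unfold wedgePair; ring

theorem wedgePair_tilde (W V : Matrix (Fin 4) (Fin 4) ℝ) :
    wedgePair (tilde W) (tilde V) = wedgePair W V := by
  simp [wedgePair, tilde, antisymm]; ring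

/-- The Clifford relation of the (3,3) form: bivectors act between the two half-spin spaces, which
are ℝ⁴ and its dual. For `W = V` it is the Pfaffian identity. -/
theorem mul_tilde_add {W V : Matrix (Fin 4) (Fin 4) ℝ} (hW : Wᵀ = -W) (hV : Vᵀ = -V) :
    W * tilde V + V * tilde W = -wedgePair W V • (1 : Matrix (Fin 4) (Fin 4) ℝ) := by
  obtain ⟨a, b, c, d, e, f, rfl⟩ := exists_eq_antisymm hW
  obtain ⟨a', b', c', d', e', f', rfl⟩ := exists_eq_antisymm hV
  ext i j
  fin_cases i <;> fin_cases j <;>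
    simp [tilde, antisymm, wedgePair] <;> ring

theorem tilde_mul_add {W V : Matrix (Fin 4) (Fin 4) ℝ} (hW : Wᵀ = -W) (hV : Vᵀ = -V) :
    tilde W * V + tilde V * W = -wedgePair W V • (1 : Matrix (Fin 4) (Fin 4) ℝ) := by
  have := mul_tilde_add (tilde_transpose W) (tilde_transpose V)
  rwa [tilde_tilde hW, tilde_tilde hV, wedgePair_tilde] at this

theorem mul_tilde_self {W : Matrix (Fin 4) (Fin 4) ℝ} (hW : Wᵀ = -W) (h : wedgePair W W = 0) :
    W * tilde W = 0 := by
  have := mul_tilde_add hW hW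
  rw [h, neg_zero, zero_smul, ← two_smul ℝ] at this
  exact (smul_eq_zero.1 this).resolve_left two_ne_zero

theorem tilde_mul_self {W : Matrix (Fin 4) (Fin 4) ℝ} (hW : Wᵀ = -W) (h : wedgePair W W = 0) :
    tilde W * W = 0 := by
  have := mul_tilde_self (tilde_transpose W) (by rwa [wedgePair_tilde])
  rwa [tilde_tilde hW] at this

/-! ### Isotropic triples of bivectors and their pure spinors -/

/-- The product `X₁ X̃₂ X₃` of pairwise orthogonal null bivectors is killed by each `X̃ᵢ`. -/
theorem tilde_mul_triple {X₁ X₂ X₃ : Matrix (Fin 4) (Fin 4) ℝ}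
    (h₁ : X₁ᵀ = -X₁) (h₂ : X₂ᵀ = -X₂) (h₃ : X₃ᵀ = -X₃)
    (h11 : wedgePair X₁ X₁ = 0) (h22 : wedgePair X₂ X₂ = 0) (h33 : wedgePair X₃ X₃ = 0)
    (h12 : wedgePair X₁ X₂ = 0) (h13 : wedgePair X₁ X₃ = 0) (h23 : wedgePair X₂ X₃ = 0) :
    tilde X₁ * (X₁ * tilde X₂ * X₃) = 0 ∧ tilde X₂ * (X₁ * tilde X₂ * X₃) = 0 ∧
      tilde X₃ * (X₁ * tilde X₂ * X₃) = 0 := by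
  have t12 := tilde_mul_add h₁ h₂
  have t13 := tilde_mul_add h₁ h₃
  have m23 := mul_tilde_add h₂ h₃
  rw [h12, neg_zero, zero_smul, add_comm, add_eq_zero_iff_eq_neg] at t12
  rw [h13, neg_zero, zero_smul, add_comm, add_eq_zero_iff_eq_neg] at t13
  rw [h23, neg_zero, zero_smul, add_comm, add_eq_zero_iff_eq_neg] at m23
  -- Orthogonal factors anticommute, so each `X̃ᵢ` can be moved through the word until `Xᵢ` and
  -- `X̃ᵢ` stand side by side; their product vanishes because `Xᵢ` is null.
  refine ⟨?_, ?_, ?_⟩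
  · rw [← mul_assoc, ← mul_assoc, tilde_mul_self h₁ h11, zero_mul, zero_mul]
  · rw [← mul_assoc, ← mul_assoc, t12, neg_mul, neg_mul, mul_assoc (tilde X₁),
      mul_tilde_self h₂ h22]
    simp
  · rw [← mul_assoc, ← mul_assoc, t13, neg_mul, neg_mul, mul_assoc (tilde X₁), m23]
    simp only [mul_neg, neg_mul, mul_assoc, tilde_mul_self h₃ h33, mul_zero, neg_zero]

/-- Three pairwise orthogonal null bivectors forming a hyperbolic system with three others have a
common line, or lie in a common hyperplane. -/
theorem exists_common_kernel {X₁ X₂ X₃ Y₂ Y₃ : Matrix (Fin 4) (Fin 4) ℝ} {κ : ℝ} (hκ : κ ≠ 0)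
    (h₁ : X₁ᵀ = -X₁) (h₂ : X₂ᵀ = -X₂) (h₃ : X₃ᵀ = -X₃)
    (k₂ : Y₂ᵀ = -Y₂) (k₃ : Y₃ᵀ = -Y₃)
    (h11 : wedgePair X₁ X₁ = 0) (h22 : wedgePair X₂ X₂ = 0) (h33 : wedgePair X₃ X₃ = 0)
    (h12 : wedgePair X₁ X₂ = 0) (h13 : wedgePair X₁ X₃ = 0) (h23 : wedgePair X₂ X₃ = 0)
    (hX : X₁ ≠ 0) (k22 : wedgePair X₂ Y₂ = κ) (k33 : wedgePair X₃ Y₃ = κ)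
    (k12 : wedgePair X₁ Y₂ = 0) (k13 : wedgePair X₁ Y₃ = 0) (k23 : wedgePair X₂ Y₃ = 0) :
    (∃ a, a ≠ 0 ∧ tilde X₁ *ᵥ a = 0 ∧ tilde X₂ *ᵥ a = 0 ∧ tilde X₃ *ᵥ a = 0) ∨
      ∃ a, a ≠ 0 ∧ X₁ *ᵥ a = 0 ∧ X₂ *ᵥ a = 0 ∧ X₃ *ᵥ a = 0 := by
  have column : ∀ {M : Matrix (Fin 4) (Fin 4) ℝ}, M ≠ 0 → ∃ j, M.col j ≠ 0 := by
    intro M hM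
    by_contra! h
    exact hM (by ext i j; exact congrFun (h j) i)
  have kill : ∀ {X M : Matrix (Fin 4) (Fin 4) ℝ} (j), X * M = 0 → X *ᵥ M.col j = 0 := by
    intro X M j h
    ext i
    exact congrFun (congrFun h i) j
  by_cases hM : X₁ * tilde X₂ * X₃ = 0
  swap
  · left
    obtain ⟨j, hj⟩ := column hM
    obtain ⟨a1, a2, a3⟩ := tilde_mul_triple h₁ h₂ h₃ h11 h22 h33 h12 h13 h23
    exact ⟨_, hj, kill j a1, kill j a2, kill j a3⟩
  by_cases hM' : tilde X₁ * X₂ * tilde X₃ = 0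
  swap
  · right
    obtain ⟨j, hj⟩ := column hM'
    have := tilde_mul_triple (tilde_transpose X₁) (tilde_transpose X₂) (tilde_transpose X₃)
      (by rwa [wedgePair_tilde]) (by rwa [wedgePair_tilde]) (by rwa [wedgePair_tilde])
      (by rwa [wedgePair_tilde]) (by rwa [wedgePair_tilde]) (by rwa [wedgePair_tilde])
    rw [tilde_tilde h₁, tilde_tilde h₂, tilde_tilde h₃] at this
    obtain ⟨a1, a2, a3⟩ := this
    exact ⟨_, hj, kill j a1, kill j a2, kill j a3⟩
  -- With both words zero, the dual partners strip off factors: inserting `-κ = X₃ Ỹ₃ + Y₃ X̃₃`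
  -- after two letters and anticommuting `Y₃` to the left leaves only multiples of the two words.
  exfalso
  have cancel : ∀ {M : Matrix (Fin 4) (Fin 4) ℝ}, -κ • M = 0 → M = 0 := fun h =>
    (smul_eq_zero.1 h).resolve_left (neg_ne_zero.2 hκ)
  -- `X₁ X̃₂ X₃ = 0 = X̃₁ X₂ X̃₃` forces `X₁ X̃₂ = 0`
  have m33 := mul_tilde_add h₃ k₃
  have t33 := tilde_mul_add h₃ k₃
  have m23 := mul_tilde_add h₂ k₃
  have t23 := tilde_mul_add h₂ k₃
  have m13 := mul_tilde_add h₁ k₃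
  have t13 := tilde_mul_add h₁ k₃
  have t22 := tilde_mul_add h₂ k₂
  have m12 := mul_tilde_add h₁ k₂
  rw [k33] at m33 t33
  rw [k22] at t22
  rw [k12, neg_zero, zero_smul, add_eq_zero_iff_eq_neg] at m12
  rw [k13, neg_zero, zero_smul, add_eq_zero_iff_eq_neg] at m13 t13
  rw [k23, neg_zero, zero_smul, add_eq_zero_iff_eq_neg] at m23 t23
  have a : X₁ * tilde X₂ = 0 := by
    apply cancel
    calc -κ • (X₁ * tilde X₂) = X₁ * tilde X₂ * (-κ • 1) := by simp
      _ = X₁ * tilde X₂ * X₃ * tilde Y₃ + X₁ * (tilde X₂ * Y₃) * tilde X₃ := by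
        rw [← m33]; noncomm_ring
      _ = -(X₁ * tilde Y₃) * X₂ * tilde X₃ := by rw [hM, t23]; noncomm_ring
      _ = Y₃ * (tilde X₁ * X₂ * tilde X₃) := by rw [m13]; noncomm_ring
      _ = 0 := by rw [hM', mul_zero]
  have b : tilde X₁ * X₂ = 0 := by
    apply cancel
    calc -κ • (tilde X₁ * X₂) = tilde X₁ * X₂ * (-κ • 1) := by simp
      _ = tilde X₁ * X₂ * tilde X₃ * Y₃ + tilde X₁ * (X₂ * tilde Y₃) * X₃ := by
        rw [← t33]; noncomm_ring
      _ = -(tilde X₁ * Y₃) * tilde X₂ * X₃ := by rw [hM', m23]; noncomm_ring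
      _ = tilde Y₃ * (X₁ * tilde X₂ * X₃) := by rw [t13]; noncomm_ring
      _ = 0 := by rw [hM, mul_zero]
  -- The same device with `Y₂` removes the second letter and leaves `X₁ = 0`.
  refine hX (cancel ?_)
  calc -κ • X₁ = X₁ * (-κ • 1) := by simp
    _ = X₁ * tilde X₂ * Y₂ + X₁ * tilde Y₂ * X₂ := by rw [← t22]; noncomm_ring
    _ = -(Y₂ * (tilde X₁ * X₂)) := by rw [a, m12]; noncomm_ring
    _ = 0 := by rw [b]; simp

/-! ### Reconstruction of a frame from its wedge products -/

theorem wedge_transpose (u v : Mink) : (wedge u v)ᵀ = -wedge u v := by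
  ext i j; simp [wedge]; ring

theorem wedge_mulVec (P : Matrix (Fin 4) (Fin 4) ℝ) (u v : Mink) :
    wedge (P *ᵥ u) (P *ᵥ v) = P * wedge u v * Pᵀ := by
  have : ∀ u v : Mink, wedge u v = Matrix.vecMulVec u v - Matrix.vecMulVec v u := fun u v => by
    ext i j; simp [wedge, Matrix.vecMulVec_apply, mul_comm]
  rw [this, this, mul_sub, sub_mul, Matrix.mul_vecMulVec, Matrix.mul_vecMulVec,
    Matrix.vecMulVec_mul, Matrix.vecMulVec_mul, Matrix.vecMul_transpose, Matrix.vecMul_transpose]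

/-- Conjugation is the action of `P` on bivectors, and `P` acts on 4-vectors by its determinant. -/
theorem wedgePair_conj (P : Matrix (Fin 4) (Fin 4) ℝ) {Z Z' : Matrix (Fin 4) (Fin 4) ℝ}
    (h : Zᵀ = -Z) (h' : Z'ᵀ = -Z') :
    wedgePair (P * Z * Pᵀ) (P * Z' * Pᵀ) = P.det * wedgePair Z Z' := by
  obtain ⟨a, b, c, d, e, f, rfl⟩ := exists_eq_antisymm h
  obtain ⟨a', b', c', d', e', f', rfl⟩ := exists_eq_antisymm h'
  have key : ∀ (a b c d e f : ℝ) (i j : Fin 4), (P * antisymm a b c d e f * Pᵀ) i j =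
      a * (P i 0 * P j 1 - P i 1 * P j 0) + b * (P i 0 * P j 2 - P i 2 * P j 0) +
      c * (P i 0 * P j 3 - P i 3 * P j 0) + d * (P i 1 * P j 2 - P i 2 * P j 1) +
      e * (P i 1 * P j 3 - P i 3 * P j 1) + f * (P i 2 * P j 3 - P i 3 * P j 2) := by
    intro a b c d e f i j
    simp [Matrix.mul_apply, Fin.sum_univ_four, antisymm]
    ring
  simp only [wedgePair, key]
  simp [antisymm, Matrix.det_succ_row_zero, Fin.sum_univ_succ, Fin.succAbove]
  ring

/-- A bivector annihilated by exterior multiplication with `a ≠ 0` is divisible by `a`. -/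
theorem exists_eq_wedge {X : Matrix (Fin 4) (Fin 4) ℝ} (h : Xᵀ = -X) {a : Mink} (ha : a ≠ 0)
    (hX : tilde X *ᵥ a = 0) : ∃ b, X = wedge a b := by
  obtain ⟨k, hk⟩ := Function.ne_iff.1 ha
  have h0 := congrFun hX 0
  have h1 := congrFun hX 1
  have h2 := congrFun hX 2
  have h3 := congrFun hX 3
  obtain ⟨p, q, r, s, t, u, rfl⟩ := exists_eq_antisymm h
  simp [tilde, antisymm, Matrix.mulVec, dotProduct, Fin.sum_univ_four] at h0 h1 h2 h3
  -- If `X = a ∧ b`, row `k` of `X` divided by `a k` is `b` minus a multiple of `a`, which serves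
  -- equally well.
  refine ⟨fun j => antisymm p q r s t u k j / a k, ?_⟩
  fin_cases k <;> simp at hk <;> ext i j <;> fin_cases i <;> fin_cases j <;>
    simp [antisymm, wedge] <;> field_simp <;> linarith

/-- Three bivectors with the exterior products of `μ e_i ∧ e_j`, among themselves and with
`e_0 ∧ e_k`, are of this form after adding multiples of `e_0` to the other basis vectors. -/
theorem exists_shear_of_wedgePair {Y₁₂ Y₁₃ Y₂₃ : Matrix (Fin 4) (Fin 4) ℝ} {μ : ℝ} (hμ : μ ≠ 0)
    (k₁₂ : Y₁₂ᵀ = -Y₁₂) (k₁₃ : Y₁₃ᵀ = -Y₁₃) (k₂₃ : Y₂₃ᵀ = -Y₂₃) (E : Fin 4 → Mink)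
    (hE : E = fun i => Pi.single i 1)
    (h1a : wedgePair (wedge (E 0) (E 1)) Y₁₂ = 0) (h1b : wedgePair (wedge (E 0) (E 1)) Y₁₃ = 0)
    (h1c : wedgePair (wedge (E 0) (E 1)) Y₂₃ = μ) (h2a : wedgePair (wedge (E 0) (E 2)) Y₁₂ = 0)
    (h2b : wedgePair (wedge (E 0) (E 2)) Y₁₃ = -μ) (h2c : wedgePair (wedge (E 0) (E 2)) Y₂₃ = 0)
    (h3a : wedgePair (wedge (E 0) (E 3)) Y₁₂ = μ) (h3b : wedgePair (wedge (E 0) (E 3)) Y₁₃ = 0)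
    (h3c : wedgePair (wedge (E 0) (E 3)) Y₂₃ = 0)
    (haa : wedgePair Y₁₂ Y₁₂ = 0) (hbb : wedgePair Y₁₃ Y₁₃ = 0) (hcc : wedgePair Y₂₃ Y₂₃ = 0)
    (hab : wedgePair Y₁₂ Y₁₃ = 0) (hac : wedgePair Y₁₂ Y₂₃ = 0) (hbc : wedgePair Y₁₃ Y₂₃ = 0) :
    ∃ x y z : ℝ, Y₁₂ = μ • wedge (E 1 + x • E 0) (E 2 + y • E 0) ∧
      Y₁₃ = μ • wedge (E 1 + x • E 0) (E 3 + z • E 0) ∧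
      Y₂₃ = μ • wedge (E 2 + y • E 0) (E 3 + z • E 0) := by
  obtain ⟨p, q, r, s, t, u, rfl⟩ := exists_eq_antisymm k₁₂
  obtain ⟨p', q', r', s', t', u', rfl⟩ := exists_eq_antisymm k₁₃
  obtain ⟨p₂, q₂, r₂, s₂, t₂, u₂, rfl⟩ := exists_eq_antisymm k₂₃
  subst hE
  simp [wedgePair, wedge, antisymm] at h1a h1b h1c h2a h2b h2c h3a h3b h3c
  subst h1a h1b h1c h2a h2b h2c h3a h3b h3c
  simp [wedgePair, antisymm] at haa hbb hcc hab hac hbc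
  -- The pairings with `e_0 ∧ e_k` have fixed all components without index 0. Nullity and
  -- orthogonality are then six linear equations on the nine components `0j`; the three remaining
  -- parameters are the shear, with `s` now standing for `μ`.
  have e1 : r = 0 := mul_left_cancel₀ hμ (by linarith)
  have e2 : q' = 0 := mul_left_cancel₀ hμ (by linarith)
  have e3 : p₂ = 0 := mul_left_cancel₀ hμ (by linarith)
  have e4 : r' = q := mul_left_cancel₀ hμ (by linarith)
  have e5 : r₂ = -p := mul_left_cancel₀ hμ (by linarith)
  have e6 : q₂ = p' := mul_left_cancel₀ hμ (by linarith)
  subst e1 e2 e3 e4 e5 e6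
  refine ⟨r' / s, -p / s, -q₂ / s, ?_, ?_, ?_⟩ <;> ext i j <;> fin_cases i <;> fin_cases j <;>
    simp [antisymm, wedge] <;> field_simp <;> simp

theorem wedge_self (u : Mink) : wedge u u = 0 := by
  ext i j; simp [wedge]

theorem wedge_smul_left (c : ℝ) (u v : Mink) : wedge (c • u) v = c • wedge u v := by
  ext i j; simp [wedge]; ring

theorem wedge_smul_right (c : ℝ) (u v : Mink) : wedge u (c • v) = c • wedge u v := by
  ext i j; simp [wedge]; ring

theorem wedge_add_right (u v w : Mink) : wedge u (v + w) = wedge u v + wedge u w := by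
  ext i j; simp [wedge]; ring

theorem wedgePair_smul_left (c : ℝ) (W V : Matrix (Fin 4) (Fin 4) ℝ) :
    wedgePair (c • W) V = c * wedgePair W V := by
  simp [wedgePair]; ring

theorem wedgePair_add_left (W W' V : Matrix (Fin 4) (Fin 4) ℝ) :
    wedgePair (W + W') V = wedgePair W V + wedgePair W' V := by
  simp [wedgePair]; ring

/-- A family of bivectors with the exterior products of `e_p ∧ e_q` is, up to sign, of this form
if the three bivectors `w 0 i` have a common line. -/
theorem exists_frame {w : Fin 4 → Fin 4 → Matrix (Fin 4) (Fin 4) ℝ} {κ : ℝ} (hκ : κ ≠ 0)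
    (hw : ∀ p q, (w p q)ᵀ = -w p q) (hanti : ∀ p q, w q p = -w p q)
    (h : ∀ p q r s, wedgePair (w p q) (w r s) = κ * epsUp p q r s) {a : Mink} (ha : a ≠ 0)
    (h1 : tilde (w 0 1) *ᵥ a = 0) (h2 : tilde (w 0 2) *ᵥ a = 0) (h3 : tilde (w 0 3) *ᵥ a = 0) :
    ∃ (s : ℝ) (e : Fin 4 → Mink), (s = 1 ∨ s = -1) ∧ ∀ p q, w p q = s • wedge (e p) (e q) := by
  obtain ⟨b₁, hb₁⟩ := exists_eq_wedge (hw 0 1) ha h1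
  obtain ⟨b₂, hb₂⟩ := exists_eq_wedge (hw 0 2) ha h2
  obtain ⟨b₃, hb₃⟩ := exists_eq_wedge (hw 0 3) ha h3
  have eps : ∀ p q r s, epsUp p q r s = (epsilon ![p, q, r, s] : ℤ) := fun _ _ _ _ => rfl
  have ev : ∀ {p q r s : Fin 4} (n : ℤ), epsilon ![p, q, r, s] = n →
      wedgePair (w p q) (w r s) = κ * n := by
    intro p q r s n hn
    rw [h, eps, hn]
  set P : Matrix (Fin 4) (Fin 4) ℝ := (Matrix.of ![a, b₁, b₂, b₃])ᵀ with hP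
  set E : Fin 4 → Mink := fun i => Pi.single i 1 with hE
  have hPv : ∀ v : Mink, P *ᵥ v = v 0 • a + v 1 • b₁ + v 2 • b₂ + v 3 • b₃ := by
    intro v
    ext i
    simp [hP, Matrix.mulVec, dotProduct, Fin.sum_univ_four, mul_comm]
  have hP0 : P *ᵥ E 0 = a := by rw [hPv]; simp [hE]
  have hP1 : P *ᵥ E 1 = b₁ := by rw [hPv]; simp [hE]
  have hP2 : P *ᵥ E 2 = b₂ := by rw [hPv]; simp [hE]
  have hP3 : P *ᵥ E 3 = b₃ := by rw [hPv]; simp [hE]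
  have hdet : P.det ≠ 0 := by
    intro h0
    obtain ⟨v, hv, hv0⟩ := Matrix.exists_mulVec_eq_zero_iff.2 h0
    rw [hPv] at hv0
    -- A linear relation among `a, b₁, b₂, b₃`, wedged with `a`, is one among the `w 0 i`; pairing
    -- with the opposite `w j k` kills its coefficients.
    have hX : v 1 • w 0 1 + v 2 • w 0 2 + v 3 • w 0 3 = 0 := by
      have : wedge a (v 0 • a + v 1 • b₁ + v 2 • b₂ + v 3 • b₃) = 0 := by
        rw [hv0]; ext i j; simp [wedge]
      rw [hb₁, hb₂, hb₃, ← this]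
      simp only [wedge_add_right, wedge_smul_right, wedge_self, smul_zero, zero_add]
    have pair : ∀ V, v 1 * wedgePair (w 0 1) V + v 2 * wedgePair (w 0 2) V +
        v 3 * wedgePair (w 0 3) V = 0 := by
      intro V
      rw [← wedgePair_smul_left, ← wedgePair_smul_left, ← wedgePair_smul_left,
        ← wedgePair_add_left, ← wedgePair_add_left, hX]
      simp [wedgePair]
    have v1 := pair (w 2 3)
    rw [ev 1 (by decide), ev 0 (by decide), ev 0 (by decide)] at v1
    have v2 := pair (w 1 3)
    rw [ev 0 (by decide), ev (-1) (by decide), ev 0 (by decide)] at v2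
    have v3 := pair (w 1 2)
    rw [ev 0 (by decide), ev 0 (by decide), ev 1 (by decide)] at v3
    simp [hκ] at v1 v2 v3
    simp [v1, v2, v3, ha] at hv0
    apply hv
    ext i
    fin_cases i <;> simp [*]
  have hu : IsUnit P.det := isUnit_iff_ne_zero.2 hdet
  have hpull : ∀ Y : Matrix (Fin 4) (Fin 4) ℝ, P * (P⁻¹ * Y * P⁻¹ᵀ) * Pᵀ = Y := by
    intro Y
    calc P * (P⁻¹ * Y * P⁻¹ᵀ) * Pᵀ = (P * P⁻¹) * Y * (P * P⁻¹)ᵀ := by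
          rw [Matrix.transpose_mul]; simp only [mul_assoc]
      _ = Y := by rw [Matrix.mul_nonsing_inv _ hu]; simp
  have hZt : ∀ p q, (P⁻¹ * w p q * P⁻¹ᵀ)ᵀ = -(P⁻¹ * w p q * P⁻¹ᵀ) := by
    intro p q
    rw [Matrix.transpose_mul, Matrix.transpose_mul, hw]
    simp [mul_assoc]
  have hpair : ∀ {p q r s : Fin 4} (n : ℤ), epsilon ![p, q, r, s] = n →
      wedgePair (P⁻¹ * w p q * P⁻¹ᵀ) (P⁻¹ * w r s * P⁻¹ᵀ) = κ / P.det * n := by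
    intro p q r s n hn
    have := wedgePair_conj P (hZt p q) (hZt r s)
    rw [hpull, hpull, ev n hn] at this
    field_simp
    linarith
  have hX : ∀ {i : Fin 4} {b : Mink}, w 0 i = wedge a b → P *ᵥ E i = b →
      P⁻¹ * w 0 i * P⁻¹ᵀ = wedge (E 0) (E i) := by
    intro i b hb hPi
    rw [hb, ← hP0, ← hPi, wedge_mulVec]
    calc P⁻¹ * (P * wedge (E 0) (E i) * Pᵀ) * P⁻¹ᵀ
        = (P⁻¹ * P) * wedge (E 0) (E i) * (P⁻¹ * P)ᵀ := by
          rw [Matrix.transpose_mul]; simp only [mul_assoc]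
      _ = wedge (E 0) (E i) := by rw [Matrix.nonsing_inv_mul _ hu]; simp
  set μ := κ / P.det with hμ
  have hμ0 : μ ≠ 0 := div_ne_zero hκ hdet
  obtain ⟨x, y, z, hz12, hz13, hz23⟩ := exists_shear_of_wedgePair hμ0 (hZt 1 2) (hZt 1 3) (hZt 2 3) E hE
    (by rw [← hX hb₁ hP1, hpair 0 (by decide)]; simp)
    (by rw [← hX hb₁ hP1, hpair 0 (by decide)]; simp)
    (by rw [← hX hb₁ hP1, hpair 1 (by decide)]; simp)
    (by rw [← hX hb₂ hP2, hpair 0 (by decide)]; simp)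
    (by rw [← hX hb₂ hP2, hpair (-1) (by decide)]; simp)
    (by rw [← hX hb₂ hP2, hpair 0 (by decide)]; simp)
    (by rw [← hX hb₃ hP3, hpair 1 (by decide)]; simp)
    (by rw [← hX hb₃ hP3, hpair 0 (by decide)]; simp)
    (by rw [← hX hb₃ hP3, hpair 0 (by decide)]; simp)
    (by rw [hpair 0 (by decide)]; simp) (by rw [hpair 0 (by decide)]; simp)
    (by rw [hpair 0 (by decide)]; simp) (by rw [hpair 0 (by decide)]; simp)
    (by rw [hpair 0 (by decide)]; simp) (by rw [hpair 0 (by decide)]; simp)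
  -- push the normal form forward and rescale
  set f : Fin 4 → Mink := ![a, b₁ + x • a, b₂ + y • a, b₃ + z • a] with hf
  have push : ∀ {p q : Fin 4} {u v : Mink}, P⁻¹ * w p q * P⁻¹ᵀ = μ • wedge u v →
      w p q = μ • wedge (P *ᵥ u) (P *ᵥ v) := by
    intro p q u v huv
    rw [← hpull (w p q), huv, wedge_mulVec]
    simp
  have w12 : w 1 2 = μ • wedge (f 1) (f 2) := by
    rw [push hz12]; simp [Matrix.mulVec_add, Matrix.mulVec_smul, hP0, hP1, hP2, hf]
  have w13 : w 1 3 = μ • wedge (f 1) (f 3) := by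
    rw [push hz13]; simp [Matrix.mulVec_add, Matrix.mulVec_smul, hP0, hP1, hP3, hf]
  have w23 : w 2 3 = μ • wedge (f 2) (f 3) := by
    rw [push hz23]; simp [Matrix.mulVec_add, Matrix.mulVec_smul, hP0, hP2, hP3, hf]
  have w01 : w 0 1 = wedge (f 0) (f 1) := by
    rw [hb₁]; simp [hf, wedge_add_right, wedge_smul_right, wedge_self]
  have w02 : w 0 2 = wedge (f 0) (f 2) := by
    rw [hb₂]; simp [hf, wedge_add_right, wedge_smul_right, wedge_self]
  have w03 : w 0 3 = wedge (f 0) (f 3) := by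
    rw [hb₃]; simp [hf, wedge_add_right, wedge_smul_right, wedge_self]
  obtain ⟨s, l, hs, hl, hsl⟩ : ∃ s l : ℝ, (s = 1 ∨ s = -1) ∧ l ≠ 0 ∧ μ = s * l ^ 2 := by
    rcases lt_or_gt_of_ne hμ0 with h | h
    · exact ⟨-1, √(-μ), .inr rfl, (Real.sqrt_pos.2 (by linarith)).ne',
        by rw [Real.sq_sqrt (by linarith)]; ring⟩
    · exact ⟨1, √μ, .inl rfl, (Real.sqrt_pos.2 h).ne', by rw [Real.sq_sqrt h.le]; ring⟩
  have hss : s * s = 1 := by rcases hs with rfl | rfl <;> norm_num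
  -- So far `w 0 i = f_0 ∧ f_i` but `w i j = μ f_i ∧ f_j`. With `μ = s l²`, these weights give
  -- factors `s · (s / l) · l = 1` and `s · l² = μ`; the sign of `μ` cannot be absorbed.
  refine ⟨s, ![(s / l) • f 0, l • f 1, l • f 2, l • f 3], hs, ?_⟩
  have diag : ∀ p, w p p = 0 := fun p => by
    have := hanti p p
    rwa [eq_neg_iff_add_eq_zero, ← two_smul ℝ, smul_eq_zero_iff_right two_ne_zero] at this
  have swap : ∀ u v : Mink, wedge u v = -wedge v u := fun u v => by
    ext i j; simp [wedge]
  have lt : ∀ p q : Fin 4, p < q → w p q = s • wedge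
      ((![(s / l) • f 0, l • f 1, l • f 2, l • f 3] : Fin 4 → Mink) p)
      ((![(s / l) • f 0, l • f 1, l • f 2, l • f 3] : Fin 4 → Mink) q) := by
    have c0 : s * (l * (s / l)) = 1 := by field_simp; linarith
    have c1 : s * (l * l) = μ := by rw [hsl]; ring
    intro p q hpq
    fin_cases p <;> fin_cases q <;> first
      | exact absurd hpq (by decide)
      | simp [wedge_smul_left, wedge_smul_right, smul_smul, c0, c1, w01, w02, w03, w12, w13, w23]
  intro p q
  rcases lt_trichotomy p q with hpq | rfl | hpq
  · exact lt p q hpq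
  · rw [diag, wedge_self, smul_zero]
  · rw [hanti q p, lt q p hpq, swap, smul_neg, neg_neg]

/-! ### The Hodge dual, the pairing and the structure constants in components -/

theorem sum_epsUp_mul (t : Fin 4 → Fin 4 → Fin 4 → Fin 4 → ℝ) :
    ∑ a, ∑ b, ∑ c, ∑ d, epsUp a b c d * t a b c d =
      t 0 1 2 3 - t 0 1 3 2 - t 0 2 1 3 + t 0 2 3 1 + t 0 3 1 2 - t 0 3 2 1 -
      t 1 0 2 3 + t 1 0 3 2 + t 1 2 0 3 - t 1 2 3 0 - t 1 3 0 2 + t 1 3 2 0 +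
      t 2 0 1 3 - t 2 0 3 1 - t 2 1 0 3 + t 2 1 3 0 + t 2 3 0 1 - t 2 3 1 0 -
      t 3 0 1 2 + t 3 0 2 1 + t 3 1 0 2 - t 3 1 2 0 - t 3 2 0 1 + t 3 2 1 0 := by
  have h : ∀ a b c d, epsUp a b c d = ((epsilon ![a, b, c, d] : ℤ) : ℝ) := fun _ _ _ _ => rfl
  have inner : ∀ a b, ∑ c, ∑ d, epsUp a b c d * t a b c d =
      epsUp a b 0 1 * t a b 0 1 + epsUp a b 0 2 * t a b 0 2 + epsUp a b 0 3 * t a b 0 3 +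
      epsUp a b 1 0 * t a b 1 0 + epsUp a b 1 2 * t a b 1 2 + epsUp a b 1 3 * t a b 1 3 +
      epsUp a b 2 0 * t a b 2 0 + epsUp a b 2 1 * t a b 2 1 + epsUp a b 2 3 * t a b 2 3 +
      epsUp a b 3 0 * t a b 3 0 + epsUp a b 3 1 * t a b 3 1 + epsUp a b 3 2 * t a b 3 2 := by
    intro a b
    have z : ∀ c, epsUp a b c c = 0 := by
      intro c
      have : ∀ a b c : Fin 4, epsilon ![a, b, c, c] = 0 := by decide
      rw [h, this, Int.cast_zero]
    simp only [Fin.sum_univ_four, z]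
    ring
  have p1 : ∀ {a b c d : Fin 4}, epsilon ![a, b, c, d] = 1 → epsUp a b c d = 1 := by
    intro a b c d e; rw [h, e, Int.cast_one]
  have m1 : ∀ {a b c d : Fin 4}, epsilon ![a, b, c, d] = -1 → epsUp a b c d = -1 := by
    intro a b c d e; rw [h, e]; norm_num
  have z1 : ∀ {a b c d : Fin 4}, epsilon ![a, b, c, d] = 0 → epsUp a b c d = 0 := by
    intro a b c d e; rw [h, e, Int.cast_zero]
  simp only [inner]
  simp (discharger := decide) only [Fin.sum_univ_four, p1, m1, z1]
  ring

/-- On distinct indices the four factors of `η` multiply to `det η = -1`. -/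
theorem epsDown_eq (I J K L : Fin 4) : epsDown I J K L = -epsUp I J K L := by
  have key : ∀ I J K L : Fin 4, (![-1, 1, 1, 1] : Fin 4 → ℤ) I * (![-1, 1, 1, 1] : Fin 4 → ℤ) J *
      (![-1, 1, 1, 1] : Fin 4 → ℤ) K * (![-1, 1, 1, 1] : Fin 4 → ℤ) L *
      epsilon ![I, J, K, L] = -epsilon ![I, J, K, L] := by decide
  have cast : ∀ I : Fin 4, (![-1, 1, 1, 1] : Fin 4 → ℝ) I =
      (((![-1, 1, 1, 1] : Fin 4 → ℤ) I : ℤ) : ℝ) := by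
    intro I; fin_cases I <;> simp
  simp only [epsDown, eta, Matrix.diagonal_apply, ite_mul, mul_ite, zero_mul, mul_zero,
    Finset.sum_ite_eq, Finset.mem_univ, if_true, epsUp, cast]
  exact_mod_cast key I J K L

theorem upper_transpose (X : so31) : (upper X)ᵀ = -upper X := by
  have h : (X : Matrix (Fin 4) (Fin 4) ℝ)ᵀ * eta = -(eta * (X : Matrix (Fin 4) (Fin 4) ℝ)) := by
    have := (mem_skewAdjointMatricesLieSubalgebra eta X.1).1 X.2
    have := (mem_skewAdjointMatricesSubmodule (J := eta) (A₁ := X.1)).1 this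
    simpa [Matrix.IsSkewAdjoint, Matrix.IsAdjointPair] using this
  have hη : eta * eta = 1 := by
    rw [eta, Matrix.diagonal_mul_diagonal, ← Matrix.diagonal_one]
    congr 1; ext i; fin_cases i <;> simp
  have hηt : etaᵀ = eta := Matrix.diagonal_transpose _
  calc (upper X)ᵀ = eta * ((X : Matrix (Fin 4) (Fin 4) ℝ)ᵀ * eta) * eta := by
        rw [upper, Matrix.transpose_mul, hηt]; simp only [mul_assoc, hη, mul_one]
    _ = -upper X := by
        rw [h, mul_neg, ← mul_assoc, hη, one_mul, neg_mul]; rfl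

/-- The 4 counts the orderings inside the two antisymmetric index pairs; the sign comes from
lowering the indices of `ε`. -/
theorem epsPair_eq (X Y : so31) : epsPair X Y = -4 * wedgePair (upper X) (upper Y) := by
  obtain ⟨a, b, c, d, e, f, hX⟩ := exists_eq_antisymm (upper_transpose X)
  obtain ⟨a', b', c', d', e', f', hY⟩ := exists_eq_antisymm (upper_transpose Y)
  simp only [epsPair, epsDown_eq, hX, hY, neg_mul, Finset.sum_neg_distrib, mul_assoc]
  rw [sum_epsUp_mul]
  simp [antisymm, wedgePair]
  ring

theorem hodge_antisymm (a b c d e f : ℝ) :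
    hodge (antisymm a b c d e f) = antisymm f (-e) d (-c) b (-a) := by
  have key : ∀ W I J, hodge W I J = ∑ K, ∑ L, epsUp I J K L *
      (1 / 2 * ((![-1, 1, 1, 1] : Fin 4 → ℝ) K * (![-1, 1, 1, 1] : Fin 4 → ℝ) L * W K L)) := by
    intro W I J
    simp only [hodge, eta, Matrix.diagonal_apply, mul_ite, mul_zero, ite_mul, zero_mul,
      Finset.sum_ite_eq', Finset.mem_univ, if_true, Finset.mul_sum]
    refine Finset.sum_congr rfl fun K _ => Finset.sum_congr rfl fun L _ => ?_
    ring
  -- Kronecker deltas turn the two free indices into summed ones, so that the 24-term expansion of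
  -- `sum_epsUp_mul` applies.
  have dist : ∀ W I J, hodge W I J = ∑ A, ∑ B, ∑ K, ∑ L, epsUp A B K L *
      ((if A = I then 1 else 0) * (if B = J then 1 else 0) *
      (1 / 2 * ((![-1, 1, 1, 1] : Fin 4 → ℝ) K * (![-1, 1, 1, 1] : Fin 4 → ℝ) L * W K L))) := by
    intro W I J
    refine (((Finset.sum_eq_single I ?_ ?_).trans (Finset.sum_eq_single J ?_ ?_)).trans ?_).symm
    · intro A _ hA; simp [hA]
    · simp
    · intro B _ hB; simp [hB]
    · simp
    · simp [key]
  ext I J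
  rw [dist, sum_epsUp_mul]
  fin_cases I <;> fin_cases J <;> simp [antisymm] <;> ring

theorem eta_mul_eta : eta * eta = 1 := by
  rw [eta, Matrix.diagonal_mul_diagonal, ← Matrix.diagonal_one]
  congr 1; ext i; fin_cases i <;> simp

theorem antisymm_mul_eta (a b c d e f : ℝ) : antisymm a b c d e f * eta =
    !![0, a, b, c; a, 0, d, e; b, -d, 0, f; c, -e, -f, 0] := by
  ext i j
  rw [eta, Matrix.mul_diagonal]
  fin_cases i <;> fin_cases j <;> simp [antisymm]

/-- The element of `so(3,1)` with prescribed contravariant components, in coordinates. -/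
def ofUpper (x : Fin 6 → ℝ) : so31 :=
  ⟨antisymm (x 0) (x 1) (x 2) (x 3) (x 4) (x 5) * eta, by
    refine (mem_skewAdjointMatricesLieSubalgebra eta _).2 ?_
    refine (mem_skewAdjointMatricesSubmodule eta _).2 ?_
    simp only [Matrix.IsSkewAdjoint, Matrix.IsAdjointPair, antisymm_mul_eta]
    ext i j
    rw [eta, Matrix.mul_diagonal, Matrix.diagonal_mul]
    fin_cases i <;> fin_cases j <;> simp⟩

theorem coe_eq_upper_mul_eta (X : so31) : (X : Matrix (Fin 4) (Fin 4) ℝ) = upper X * eta := by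
  rw [upper, mul_assoc, eta_mul_eta, mul_one]

theorem upper_ofUpper (x : Fin 6 → ℝ) :
    upper (ofUpper x) = antisymm (x 0) (x 1) (x 2) (x 3) (x 4) (x 5) := by
  rw [upper, ofUpper, mul_assoc, eta_mul_eta, mul_one]

/-- Coordinates on `so(3,1)`. -/
def so31Equiv : so31 ≃ₗ[ℝ] (Fin 6 → ℝ) where
  toFun X := ![upper X 0 1, upper X 0 2, upper X 0 3, upper X 1 2, upper X 1 3, upper X 2 3]
  invFun := ofUpper
  map_add' X Y := by
    ext i
    fin_cases i <;> simp [upper, add_mul]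
  map_smul' c X := by
    ext i
    fin_cases i <;> simp [upper]
  left_inv X := by
    obtain ⟨a, b, c, d, e, f, hX⟩ := exists_eq_antisymm (upper_transpose X)
    apply Subtype.ext
    rw [coe_eq_upper_mul_eta X, coe_eq_upper_mul_eta, upper_ofUpper]
    dsimp only
    rw [hX]
    simp [antisymm]
  right_inv x := by
    ext i
    dsimp only
    rw [upper_ofUpper]
    fin_cases i <;> simp [antisymm]

/-- This is the factor `n - 2` of `so(n)` at `n = 4`, obtained by evaluating the trace of `ad X ∘ ad
Y` in six coordinates. -/
theorem killingForm_eq (X Y : so31) :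
    killingForm ℝ so31 X Y =
      2 * ((X : Matrix (Fin 4) (Fin 4) ℝ) * (Y : Matrix (Fin 4) (Fin 4) ℝ)).trace := by
  obtain ⟨a, b, c, d, e, f, hX⟩ := exists_eq_antisymm (upper_transpose X)
  obtain ⟨a', b', c', d', e', f', hY⟩ := exists_eq_antisymm (upper_transpose Y)
  rw [killingForm_apply_apply, LinearMap.trace_eq_matrix_trace ℝ (Module.Basis.ofEquivFun so31Equiv)]
  have hb : ∀ Z : so31, so31Equiv Z =
    ![upper Z 0 1, upper Z 0 2, upper Z 0 3, upper Z 1 2, upper Z 1 3, upper Z 2 3] := fun _ => rfl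
  have hs : ∀ x, so31Equiv.symm x = ofUpper x := fun _ => rfl
  have hbr : ∀ Z : so31, upper ⁅X, ⁅Y, Z⁆⁆ =
      (antisymm a b c d e f * eta * (antisymm a' b' c' d' e' f' * eta * (upper Z * eta) -
        upper Z * eta * (antisymm a' b' c' d' e' f' * eta)) -
      (antisymm a' b' c' d' e' f' * eta * (upper Z * eta) -
        upper Z * eta * (antisymm a' b' c' d' e' f' * eta)) * (antisymm a b c d e f * eta)) *
          eta := by
    intro Z
    rw [upper, LieSubalgebra.coe_bracket, LieSubalgebra.coe_bracket, Ring.lie_def, Ring.lie_def,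
      coe_eq_upper_mul_eta X, coe_eq_upper_mul_eta Y, coe_eq_upper_mul_eta Z, hX, hY]
  rw [coe_eq_upper_mul_eta X, coe_eq_upper_mul_eta Y, hX, hY, Matrix.trace]
  simp only [Matrix.diag_apply, LinearMap.toMatrix_apply, Module.Basis.ofEquivFun_repr_apply,
    Module.Basis.coe_ofEquivFun, LinearMap.comp_apply, LieAlgebra.ad_apply, hb, hs, hbr,
    upper_ofUpper, Fin.sum_univ_six, antisymm_mul_eta]
  simp only [eta, Matrix.trace, Matrix.diag_apply, Fin.sum_univ_four,
    Matrix.mul_apply, Matrix.sub_apply]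
  simp
  ring

/-- Transposition reverses a product of three skew-adjoint matrices with a sign, so both halves of
the commutator contribute equally. -/
theorem structureForm_eq (X Y Z : so31) :
    structureForm X Y Z =
      4 * (upper X * eta * (upper Y * eta) * (upper Z * eta)).trace := by
  rw [structureForm, killingForm_eq, LieSubalgebra.coe_bracket, Ring.lie_def,
    coe_eq_upper_mul_eta X, coe_eq_upper_mul_eta Y, coe_eq_upper_mul_eta Z]
  have hηt : etaᵀ = eta := Matrix.diagonal_transpose _
  have : (upper Y * eta * (upper X * eta) * (upper Z * eta)).trace =
      -(upper X * eta * (upper Y * eta) * (upper Z * eta)).trace := by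
    rw [← Matrix.trace_transpose]
    have : (upper Y * eta * (upper X * eta) * (upper Z * eta))ᵀ =
        -(eta * upper Z * eta * (upper X * eta * upper Y)) := by
      simp only [Matrix.transpose_mul, upper_transpose, hηt, neg_mul, mul_neg, neg_neg, mul_assoc]
    rw [this, Matrix.trace_neg, Matrix.trace_mul_comm]
    simp only [mul_assoc]
  rw [sub_mul, Matrix.trace_sub, this]
  ring

theorem wedge_eq_antisymm (u v : Mink) : wedge u v = antisymm
    (u 0 * v 1 - v 0 * u 1) (u 0 * v 2 - v 0 * u 2) (u 0 * v 3 - v 0 * u 3)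
    (u 1 * v 2 - v 1 * u 2) (u 1 * v 3 - v 1 * u 3) (u 2 * v 3 - v 2 * u 3) := by
  ext i j
  fin_cases i <;> fin_cases j <;> simp [wedge, antisymm] <;> ring

theorem hodge_smul (c : ℝ) (W : Matrix (Fin 4) (Fin 4) ℝ) : hodge (c • W) = c • hodge W := by
  ext I J
  simp only [hodge, Matrix.smul_apply, smul_eq_mul, Finset.mul_sum]
  refine Finset.sum_congr rfl fun K _ => Finset.sum_congr rfl fun L _ => ?_
  ring

theorem hodge_add (W V : Matrix (Fin 4) (Fin 4) ℝ) : hodge (W + V) = hodge W + hodge V := by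
  ext I J
  simp only [hodge, Matrix.add_apply, mul_add, Finset.sum_add_distrib]

theorem hodge_transpose {W : Matrix (Fin 4) (Fin 4) ℝ} (h : Wᵀ = -W) :
    (hodge W)ᵀ = -hodge W := by
  obtain ⟨a, b, c, d, e, f, rfl⟩ := exists_eq_antisymm h
  rw [hodge_antisymm]
  ext i j
  fin_cases i <;> fin_cases j <;> simp [antisymm]

theorem hodge_hodge {W : Matrix (Fin 4) (Fin 4) ℝ} (h : Wᵀ = -W) : hodge (hodge W) = -W := by
  obtain ⟨a, b, c, d, e, f, rfl⟩ := exists_eq_antisymm h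
  rw [hodge_antisymm, hodge_antisymm]
  ext i j
  fin_cases i <;> fin_cases j <;> simp [antisymm]

theorem wedgePair_hodge {W V : Matrix (Fin 4) (Fin 4) ℝ} (h : Wᵀ = -W) (h' : Vᵀ = -V) :
    wedgePair (hodge W) (hodge V) = -wedgePair W V := by
  obtain ⟨a, b, c, d, e, f, rfl⟩ := exists_eq_antisymm h
  obtain ⟨a', b', c', d', e', f', rfl⟩ := exists_eq_antisymm h'
  rw [hodge_antisymm, hodge_antisymm]
  simp [wedgePair, antisymm]
  ring

/-- The two dualizations by `ε` cancel and only the lowering of indices remains. Hence a covector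
killed by `W` becomes, through `η`, a vector killed by the two-form of `∗W`. -/
theorem tilde_hodge {W : Matrix (Fin 4) (Fin 4) ℝ} (h : Wᵀ = -W) :
    tilde (hodge W) = eta * W * eta := by
  obtain ⟨a, b, c, d, e, f, rfl⟩ := exists_eq_antisymm h
  rw [hodge_antisymm]
  ext i j
  rw [eta, Matrix.mul_diagonal, Matrix.diagonal_mul]
  fin_cases i <;> fin_cases j <;> simp [tilde, antisymm]

theorem det_eq (u v w z : Mink) : Matrix.det (Matrix.of ![u, v, w, z]) =
    wedgePair (wedge u v) (wedge w z) := by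
  simp [Matrix.det_succ_row_zero, Fin.sum_univ_succ, Fin.succAbove, wedgePair, wedge]
  ring

/-- Bivectors with the exterior products of `e_p ∧ e_q` are, up to sign, of this form, or their
Hodge duals are. -/
theorem exists_frame_or_hodge {w : Fin 4 → Fin 4 → Matrix (Fin 4) (Fin 4) ℝ} {κ : ℝ} (hκ : κ ≠ 0)
    (hw : ∀ p q, (w p q)ᵀ = -w p q) (hanti : ∀ p q, w q p = -w p q)
    (h : ∀ p q r s, wedgePair (w p q) (w r s) = κ * epsUp p q r s) :
    ∃ (s : ℝ) (e : Fin 4 → Mink), (s = 1 ∨ s = -1) ∧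
      ((∀ p q, w p q = s • wedge (e p) (e q)) ∨ ∀ p q, w p q = s • hodge (wedge (e p) (e q))) := by
  have ev : ∀ {p q r s : Fin 4} (n : ℤ), epsilon ![p, q, r, s] = n →
      wedgePair (w p q) (w r s) = κ * n := by
    intro p q r s n hn
    rw [h, epsUp, hn]
  have ev0 : ∀ {p q r s : Fin 4}, epsilon ![p, q, r, s] = 0 → wedgePair (w p q) (w r s) = 0 := by
    intro p q r s hn
    rw [ev 0 hn]; simp
  have ev1 : ∀ {p q r s : Fin 4}, epsilon ![p, q, r, s] = 1 → wedgePair (w p q) (w r s) = κ := by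
    intro p q r s hn
    rw [ev 1 hn]; simp
  have hX : w 0 1 ≠ 0 := by
    intro h0
    apply hκ
    rw [← ev1 (p := 0) (q := 1) (r := 2) (s := 3) (by decide), h0]
    simp [wedgePair]
  rcases exists_common_kernel hκ (hw 0 1) (hw 0 2) (hw 0 3) (hw 3 1) (hw 1 2)
    (ev0 (by decide)) (ev0 (by decide)) (ev0 (by decide)) (ev0 (by decide)) (ev0 (by decide))
    (ev0 (by decide)) hX (ev1 (by decide)) (ev1 (by decide)) (ev0 (by decide)) (ev0 (by decide))
    (ev0 (by decide)) with ⟨a, ha, h1, h2, h3⟩ | ⟨a, ha, h1, h2, h3⟩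
  · obtain ⟨s, e, hs, he⟩ := exists_frame hκ hw hanti h ha h1 h2 h3
    exact ⟨s, e, hs, .inl he⟩
  · have kill : ∀ {p q}, w p q *ᵥ a = 0 → tilde (hodge (w p q)) *ᵥ (eta *ᵥ a) = 0 := by
      intro p q hpq
      rw [tilde_hodge (hw p q), Matrix.mulVec_mulVec, mul_assoc, eta_mul_eta, mul_one,
        ← Matrix.mulVec_mulVec, hpq, Matrix.mulVec_zero]
    have hηa : eta *ᵥ a ≠ 0 := by
      intro h0
      apply ha
      rw [← Matrix.one_mulVec a, ← eta_mul_eta, ← Matrix.mulVec_mulVec, h0, Matrix.mulVec_zero]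
    obtain ⟨s, e, hs, he⟩ := exists_frame (w := fun p q => hodge (w p q)) (neg_ne_zero.2 hκ)
      (fun p q => hodge_transpose (hw p q))
      (fun p q => by rw [hanti, ← neg_one_smul ℝ, hodge_smul, neg_one_smul])
      (fun p q r s => by rw [wedgePair_hodge (hw p q) (hw r s), h, neg_mul])
      hηa (kill h1) (kill h2) (kill h3)
    -- The sign flips because `∗∗ = -1` in Lorentzian signature.
    refine ⟨-s, e, by rcases hs with rfl | rfl <;> simp, .inr fun p q => ?_⟩
    rw [← neg_eq_iff_eq_neg.2 (hodge_hodge (hw p q)), he, hodge_smul, neg_smul]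

/-! ### The form of Urbantke type for geometric fields -/

/-- Antisymmetrizing four frame vectors gives the volume element times the determinant. -/
theorem sum_epsUp_prod (e : Fin 4 → Mink) (I J K L : Fin 4) :
    ∑ a, ∑ b, ∑ c, ∑ d, epsUp a b c d * (e a I * e b J * e c K * e d L) =
      Matrix.det (Matrix.of e) * epsUp I J K L := by
  rw [sum_epsUp_mul]
  have hdet : Matrix.det (Matrix.of e) = wedgePair (wedge (e 0) (e 1)) (wedge (e 2) (e 3)) := by
    rw [← det_eq]
    congr 2
    ext i
    fin_cases i <;> rfl
  have p1 : epsilon ![I, J, K, L] = 1 → epsUp I J K L = 1 := by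
    intro e; rw [epsUp, e, Int.cast_one]
  have m1 : epsilon ![I, J, K, L] = -1 → epsUp I J K L = -1 := by
    intro e; rw [epsUp, e]; norm_num
  have z1 : epsilon ![I, J, K, L] = 0 → epsUp I J K L = 0 := by
    intro e; rw [epsUp, e, Int.cast_zero]
  rw [hdet]
  fin_cases I <;> fin_cases J <;> fin_cases K <;> fin_cases L <;>
    first
    | (rw [z1 (by decide)]; ring)
    | (rw [p1 (by decide)]; simp [wedgePair, wedge]; ring)
    | (rw [m1 (by decide)]; simp [wedgePair, wedge]; ring)

/-- The cubic contraction `X^I_J Y^J_K Z^K_I` of three bivectors. -/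
def tripleTrace (W V U : Matrix (Fin 4) (Fin 4) ℝ) : ℝ :=
  (W * eta * (V * eta) * (U * eta)).trace

/-- The contraction `ε^{abcd} w_{qa} w_{bc} w_{dr}` of a family of bivectors. -/
def cubicForm (w : Fin 4 → Fin 4 → Matrix (Fin 4) (Fin 4) ℝ) (q r : Fin 4) : ℝ :=
  ∑ a, ∑ b, ∑ c, ∑ d, epsUp a b c d * tripleTrace (w q a) (w b c) (w d r)

theorem cubicForm_smul (s : ℝ) (w : Fin 4 → Fin 4 → Matrix (Fin 4) (Fin 4) ℝ) (q r : Fin 4) :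
    cubicForm (fun p q => s • w p q) q r = s ^ 3 * cubicForm w q r := by
  simp only [cubicForm, tripleTrace, Matrix.smul_mul, Matrix.mul_smul, Matrix.trace_smul,
    smul_eq_mul, Finset.mul_sum]
  refine Finset.sum_congr rfl fun a _ => Finset.sum_congr rfl fun b _ =>
    Finset.sum_congr rfl fun c _ => Finset.sum_congr rfl fun d _ => ?_
  ring

theorem tripleTrace_antisymm (a b c d e f a' b' c' d' e' f' a₂ b₂ c₂ d₂ e₂ f₂ : ℝ) :
    tripleTrace (antisymm a b c d e f) (antisymm a' b' c' d' e' f')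
      (antisymm a₂ b₂ c₂ d₂ e₂ f₂) =
    (!![0, a, b, c; a, 0, d, e; b, -d, 0, f; c, -e, -f, 0] *
      !![0, a', b', c'; a', 0, d', e'; b', -d', 0, f'; c', -e', -f', 0] *
      !![0, a₂, b₂, c₂; a₂, 0, d₂, e₂; b₂, -d₂, 0, f₂; c₂, -e₂, -f₂, 0]).trace := by
  rw [tripleTrace, antisymm_mul_eta, antisymm_mul_eta, antisymm_mul_eta]

/-- The contraction over a frame reduces to the contraction over the standard basis. -/
theorem cubicForm_linear (φ : Matrix (Fin 4) (Fin 4) ℝ →ₗ[ℝ] Matrix (Fin 4) (Fin 4) ℝ)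
    (e : Fin 4 → Mink) (q r : Fin 4) :
    cubicForm (fun p q => φ (wedge (e p) (e q))) q r = Matrix.det (Matrix.of e) *
      ∑ I, ∑ J, ∑ K, ∑ L, epsUp I J K L * tripleTrace (φ (wedge (e q) (Pi.single I 1)))
        (φ (wedge (Pi.single J 1) (Pi.single K 1))) (φ (wedge (Pi.single L 1) (e r))) := by
  have left : ∀ u v : Mink, wedge u v = ∑ I, v I • wedge u (Pi.single I 1) := by
    intro u v
    ext i j
    fin_cases i <;> fin_cases j <;> simp [Fin.sum_univ_four, wedge] <;> ring
  have right : ∀ u v : Mink, wedge u v = ∑ I, u I • wedge (Pi.single I 1) v := by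
    intro u v
    ext i j
    fin_cases i <;> fin_cases j <;> simp [Fin.sum_univ_four, wedge] <;> ring
  have both : ∀ u v : Mink, wedge u v =
      ∑ J, ∑ K, (u J * v K) • wedge (Pi.single J 1) (Pi.single K 1) := by
    intro u v
    rw [right u v]
    refine Finset.sum_congr rfl fun J _ => ?_
    rw [left _ v, Finset.smul_sum]
    simp only [smul_smul]
  have flat : ∀ f : Fin 4 → Fin 4 → Fin 4 → Fin 4 → ℝ, ∑ a, ∑ b, ∑ c, ∑ d, f a b c d =
      ∑ x : Fin 4 × Fin 4 × Fin 4 × Fin 4, f x.1 x.2.1 x.2.2.1 x.2.2.2 := by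
    intro f; simp only [Fintype.sum_prod_type]
  have expand : ∀ a b c d : Mink,
      tripleTrace (φ (wedge (e q) a)) (φ (wedge b c)) (φ (wedge d (e r))) =
      ∑ x : Fin 4 × Fin 4 × Fin 4 × Fin 4, (a x.1 * b x.2.1 * c x.2.2.1 * d x.2.2.2) *
        tripleTrace (φ (wedge (e q) (Pi.single x.1 1)))
          (φ (wedge (Pi.single x.2.1 1) (Pi.single x.2.2.1 1)))
          (φ (wedge (Pi.single x.2.2.2 1) (e r))) := by
    intro a b c d
    rw [left (e q) a, both b c, right d (e r)]
    simp only [tripleTrace, map_sum, map_smul, Finset.sum_mul, Finset.mul_sum, Matrix.smul_mul,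
      Matrix.mul_smul, Matrix.trace_sum, Matrix.trace_smul, smul_eq_mul]
    rw [flat]
    -- The multilinear expansion sums over the first and last indices in the opposite order.
    exact Fintype.sum_equiv ⟨fun x => (x.2.2.2, x.2.1, x.2.2.1, x.1),
      fun x => (x.2.2.2, x.2.1, x.2.2.1, x.1), fun _ => rfl, fun _ => rfl⟩ _ _
      fun x => by simp only [Equiv.coe_fn_mk]; ring
  rw [flat, Finset.mul_sum, cubicForm, flat]
  simp_rw [fun x : Fin 4 × Fin 4 × Fin 4 × Fin 4 =>
    expand (e x.1) (e x.2.1) (e x.2.2.1) (e x.2.2.2), Finset.mul_sum]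
  rw [Finset.sum_comm]
  refine Finset.sum_congr rfl fun y _ => ?_
  rw [← mul_assoc, ← sum_epsUp_prod, flat, Finset.sum_mul]
  refine Finset.sum_congr rfl fun x _ => ?_
  ring

/-- Each term of the trace contracts six vectors in three pairs by `η`. Four of them carry the
indices of `ε`, and at most two of these can be paired with `e q` and `e r`; some pair is therefore
symmetric and antisymmetric at once. -/
theorem cubicForm_wedge (e : Fin 4 → Mink) (q r : Fin 4) :
    cubicForm (fun p q => wedge (e p) (e q)) q r = 0 := by
  have := cubicForm_linear LinearMap.id e q r
  simp only [LinearMap.id_coe, id_eq] at this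
  rw [this, sum_epsUp_mul]
  refine mul_eq_zero_of_right _ ?_
  simp only [wedge_eq_antisymm, tripleTrace_antisymm, Matrix.trace, Matrix.diag_apply,
    Fin.sum_univ_four, Matrix.mul_apply]
  simp

/-- The Hodge dual as a linear map. -/
def hodgeLinear : Matrix (Fin 4) (Fin 4) ℝ →ₗ[ℝ] Matrix (Fin 4) (Fin 4) ℝ where
  toFun := hodge
  map_add' := hodge_add
  map_smul' := hodge_smul

/-- By Lorentz invariance only a multiple of `η` can appear; the components give the factor 12. -/
theorem cubicForm_hodge (e : Fin 4 → Mink) (q r : Fin 4) :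
    cubicForm (fun p q => hodge (wedge (e p) (e q))) q r =
      12 * Matrix.det (Matrix.of e) * (e q ⬝ᵥ eta *ᵥ e r) := by
  have h : ∀ W, hodgeLinear W = hodge W := fun _ => rfl
  have := cubicForm_linear hodgeLinear e q r
  simp only [h] at this
  rw [this, sum_epsUp_mul, mul_comm (12 : ℝ), mul_assoc]
  congr 1
  simp only [wedge_eq_antisymm, hodge_antisymm, tripleTrace_antisymm, Matrix.trace,
    Matrix.diag_apply, Fin.sum_univ_four, Matrix.mul_apply, eta, dotProduct, Matrix.mulVec_diagonal]
  simp
  ring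

/-! ### Rigidity of frames -/

theorem det_frame (e : Fin 4 → Mink) (p q r s : Fin 4) :
    Matrix.det (Matrix.of ![e p, e q, e r, e s]) = Matrix.det (Matrix.of e) * epsUp p q r s := by
  have := sum_epsUp_prod (fun i j => e j i) p q r s
  rw [show Matrix.of (fun i j => e j i) = (Matrix.of e)ᵀ from rfl, Matrix.det_transpose,
    sum_epsUp_mul] at this
  rw [← this, det_eq]
  simp [wedgePair, wedge]
  ring

theorem wedge_triple (a b : Mink) (i j k : Fin 4) :
    a i * wedge a b j k + a j * wedge a b k i + a k * wedge a b i j = 0 := by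
  simp only [wedge]; ring

/-- Three members of a frame are determined up to a common sign by their exterior products. -/
theorem eq_or_eq_neg_of_wedge_eq {u : Fin 4 → Mink} (hu : Matrix.det (Matrix.of u) ≠ 0)
    {i j k : Fin 4} (hij : i ≠ j) (hik : i ≠ k) (hjk : j ≠ k) {x y z : Mink}
    (hxy : wedge x y = wedge (u i) (u j)) (hxz : wedge x z = wedge (u i) (u k))
    (hyz : wedge y z = wedge (u j) (u k)) :
    ∃ s : ℝ, (s = 1 ∨ s = -1) ∧ x = s • u i ∧ y = s • u j ∧ z = s • u k := by
  set P : Matrix (Fin 4) (Fin 4) ℝ := (Matrix.of u)ᵀ with hP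
  have hPu : IsUnit P.det := by rw [hP, Matrix.det_transpose]; exact isUnit_iff_ne_zero.2 hu
  have hcol : ∀ i, P *ᵥ Pi.single i 1 = u i := by
    intro i; ext l; simp [hP]
  have hinv : ∀ x, P *ᵥ (P⁻¹ *ᵥ x) = x := by
    intro x; rw [Matrix.mulVec_mulVec, Matrix.mul_nonsing_inv _ hPu, Matrix.one_mulVec]
  have hinv' : ∀ i, P⁻¹ *ᵥ u i = Pi.single i 1 := by
    intro i
    rw [← hcol, Matrix.mulVec_mulVec, Matrix.nonsing_inv_mul _ hPu, Matrix.one_mulVec]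
  have pull : ∀ {x y : Mink} {i j : Fin 4}, wedge x y = wedge (u i) (u j) →
      wedge (P⁻¹ *ᵥ x) (P⁻¹ *ᵥ y) = wedge (Pi.single i 1) (Pi.single j 1) := by
    intro x y i j h
    rw [wedge_mulVec, h, ← wedge_mulVec, hinv', hinv']
  -- In frame coordinates, `a ∧ (a ∧ b) = 0` puts `a` in the plane of `e_i, e_j`, and likewise in
  -- that of `e_i, e_k`; the planes meet in the line of `e_i`.
  have std : ∀ {i j k : Fin 4}, i ≠ j → i ≠ k → j ≠ k → ∀ {a b c : Mink},
      wedge a b = wedge (Pi.single i 1) (Pi.single j 1) →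
      wedge a c = wedge (Pi.single i 1) (Pi.single k 1) → a = a i • Pi.single i 1 := by
    intro i j k hij hik hjk a b c hb hc
    have off : ∀ {j : Fin 4} {b : Mink}, i ≠ j →
        wedge a b = wedge (Pi.single i 1) (Pi.single j 1) → ∀ l, l ≠ i → l ≠ j → a l = 0 := by
      intro j b hij hb l hli hlj
      have := wedge_triple a b l i j
      rw [hb] at this
      simpa [wedge, hij, hij.symm, hli, hlj] using this
    ext l
    by_cases hl : l = i
    · subst hl; simp
    · rw [Pi.smul_apply, Pi.single_eq_of_ne hl, smul_zero]
      by_cases hlj : l = j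
      · exact off hik hc l hl (by rw [hlj]; exact hjk)
      · exact off hij hb l hl hlj
  have swap : ∀ u v : Mink, wedge u v = -wedge v u := fun u v => by
    ext i j; simp [wedge]
  have swap' : ∀ {x y x' y' : Mink}, wedge x y = wedge x' y' → wedge y x = wedge y' x' := by
    intro x y x' y' h
    rw [swap, h, ← swap]
  have ha := std hij hik hjk (pull hxy) (pull hxz)
  have hb := std hij.symm hjk hik (pull (swap' hxy)) (pull hyz)
  have hc := std hik.symm hjk.symm hij (pull (swap' hxz)) (pull (swap' hyz))
  set a := P⁻¹ *ᵥ x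
  set b := P⁻¹ *ᵥ y
  set c := P⁻¹ *ᵥ z
  have prod : ∀ {a b : Mink} {i j : Fin 4}, i ≠ j → a = a i • Pi.single i 1 →
      wedge a b = wedge (Pi.single i 1) (Pi.single j 1) → a i * b j = 1 := by
    intro a b i j hij ha hab
    have h1 := congrFun (congrFun hab i) j
    have h2 : a j = 0 := by rw [ha]; simp [hij.symm]
    simpa [wedge, hij, hij.symm, h2] using h1
  -- Three scalars whose pairwise products are 1 are equal and square to 1.
  have hab : a i * b j = 1 := prod hij ha (pull hxy)
  have hac : a i * c k = 1 := prod hik ha (pull hxz)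
  have hbc : b j * c k = 1 := prod hjk hb (pull hyz)
  have hsc : c k = a i :=
    mul_left_cancel₀ (right_ne_zero_of_mul_eq_one hab) (hbc.trans (by rw [mul_comm, hab]))
  have hsb : b j = a i := by
    rw [← hsc]
    exact mul_left_cancel₀ (left_ne_zero_of_mul_eq_one hab) (hab.trans hac.symm)
  have hsq : a i * a i = 1 := by rwa [hsb] at hab
  refine ⟨a i, mul_self_eq_one_iff.1 hsq, ?_, ?_, ?_⟩
  · rw [← hinv x, ← hcol i, ← Matrix.mulVec_smul]
    exact congrArg _ ha
  · rw [← hinv y, ← hcol j, ← Matrix.mulVec_smul, ← hsb]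
    exact congrArg _ hb
  · rw [← hinv z, ← hcol k, ← Matrix.mulVec_smul, ← hsc]
    exact congrArg _ hc

/-! ### Signatures -/

theorem toQuadraticForm'_apply {n : Type*} [Fintype n] [DecidableEq n] (M : Matrix n n ℝ)
    (x : n → ℝ) : M.toQuadraticForm' x = x ⬝ᵥ M *ᵥ x := by
  simp [Matrix.toQuadraticForm', Matrix.toLinearMap₂'_apply']

/-- The change of variables is `x ↦ Eᵀ (x ∘ σ)`; the bijection `σ` allows for different index types.
-/
theorem equivalent_of_congruent {m n : Type*} [Fintype m] [DecidableEq m] [Fintype n]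
    [DecidableEq n] (σ : m ≃ n) {M : Matrix n n ℝ} {E A : Matrix m m ℝ} (hE : E.det ≠ 0)
    (h : ∀ q r, M (σ q) (σ r) = (E * A * Eᵀ) q r) :
    QuadraticMap.Equivalent M.toQuadraticForm' A.toQuadraticForm' := by
  have hu : IsUnit (Eᵀ).det := by rw [Matrix.det_transpose]; exact isUnit_iff_ne_zero.2 hE
  refine ⟨⟨(LinearEquiv.funCongrLeft ℝ ℝ σ).trans
    (Matrix.toLinearEquiv' Eᵀ (Matrix.invertibleOfIsUnitDet _ hu)), fun x => ?_⟩⟩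
  have hM : M.submatrix σ σ = E * A * Eᵀ := by ext q r; exact h q r
  have hx : x ⬝ᵥ M *ᵥ x = (x ∘ σ) ⬝ᵥ (M.submatrix σ σ) *ᵥ (x ∘ σ) := by
    simp only [dotProduct, Matrix.mulVec, Matrix.submatrix_apply, Function.comp_apply]
    rw [← σ.sum_comp]
    refine Finset.sum_congr rfl fun i _ => ?_
    rw [← σ.sum_comp]
  change A.toQuadraticForm' (Eᵀ *ᵥ (x ∘ σ)) = _
  rw [toQuadraticForm'_apply, toQuadraticForm'_apply, hx, hM, Matrix.mulVec_mulVec,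
    Matrix.mulVec_transpose, ← Matrix.dotProduct_mulVec, Matrix.mulVec_mulVec, mul_assoc]

theorem sig_eta : sigPos eta.toQuadraticForm' = 3 ∧ sigNeg eta.toQuadraticForm' = 1 := by
  have h : eta.toQuadraticForm' =
      QuadraticMap.weightedSumSquares ℝ (![-1, 1, 1, 1] : Fin 4 → ℝ) := by
    ext x
    rw [toQuadraticForm'_apply]
    simp [eta, dotProduct, Matrix.mulVec_diagonal, QuadraticMap.weightedSumSquares_apply,
      Fin.sum_univ_four]
  rw [h, QuadraticForm.sigPos_weightedSumSquares, QuadraticForm.sigNeg_weightedSumSquares]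
  constructor
  · rw [show {i | 0 < (![-1, 1, 1, 1] : Fin 4 → ℝ) i} = (({1, 2, 3} : Finset (Fin 4)) : Set _) by
      ext i; fin_cases i <;> simp, Set.ncard_coe_finset]
    rfl
  · rw [show {i | (![-1, 1, 1, 1] : Fin 4 → ℝ) i < 0} = (({0} : Finset (Fin 4)) : Set _) by
      ext i; fin_cases i <;> simp, Set.ncard_coe_finset]
    rfl

theorem sigPos_zero_matrix {n : Type*} [Fintype n] [DecidableEq n] :
    sigPos (0 : Matrix n n ℝ).toQuadraticForm' = 0 := by
  have := QuadraticForm.sigPos_add_finrank_le_of_nonpos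
    (Q := (0 : Matrix n n ℝ).toQuadraticForm') (V := ⊤)
    fun x _ => by rw [toQuadraticForm'_apply]; simp
  rw [finrank_top] at this
  lia

/-! ### The lines of a corner cell -/

/-- The lines of the corner cell `c_T`, in an order for which `ε^{PQRST}` is `ε^{pqrs}`. -/
def line (T : Fin 5) (i : Fin 4) : Fin 5 := T + 1 + i.castSucc

theorem line_ne (T : Fin 5) (i : Fin 4) : line T i ≠ T := by
  revert T i; decide

theorem line_injective (T : Fin 5) : Function.Injective (line T) := by
  revert T; decide

theorem exists_line {T P : Fin 5} (h : P ≠ T) : ∃ i, line T i = P := by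
  revert T P; decide

/-- The enumeration of the lines of a corner cell. -/
def lineEquiv (T : Fin 5) : Fin 4 ≃ {P : Fin 5 // P ≠ T} :=
  Equiv.ofBijective (fun i => ⟨line T i, line_ne T i⟩)
    ⟨fun _ _ h => line_injective T (Subtype.mk.inj h),
      fun P => (exists_line P.2).imp fun _ h => Subtype.ext h⟩

theorem sum_line (T : Fin 5) {f : Fin 5 → ℝ} (h : f T = 0) : ∑ P, f P = ∑ i, f (line T i) := by
  rw [← Fintype.sum_subtype_add_sum_subtype (· ≠ T), ← (lineEquiv T).sum_comp]
  have : ∀ x : {P : Fin 5 // ¬ P ≠ T}, f x = 0 := fun x => by rw [not_not.1 x.2, h]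
  simp only [this, Finset.sum_const_zero, add_zero]
  rfl

/-- The list `T+1, …, T+4, T` is a rotation of five letters, an even permutation. -/
theorem sgn_line (T : Fin 5) (p q r s : Fin 4) :
    sgn (line T p) (line T q) (line T r) (line T s) T = epsUp p q r s := by
  have : ∀ (T : Fin 5) (p q r s : Fin 4),
    epsilon ![line T p, line T q, line T r, line T s, T] = epsilon ![p, q, r, s] := by
      decide +kernel
  rw [sgn, this, epsUp]

theorem sgn_eq_zero {P Q R S T : Fin 5}
    (h : P = T ∨ Q = T ∨ R = T ∨ S = T ∨ P = Q ∨ R = S) : sgn P Q R S T = 0 := by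
  have : ∀ P Q R S T : Fin 5, (P = T ∨ Q = T ∨ R = T ∨ S = T ∨ P = Q ∨ R = S) →
    epsilon ![P, Q, R, S, T] = 0 := by decide +kernel
  rw [sgn, this _ _ _ _ _ h, Int.cast_zero]

theorem sum_sgn_line (T : Fin 5) (f : Fin 5 → Fin 5 → Fin 5 → Fin 5 → ℝ) :
    ∑ P, ∑ Q, ∑ R, ∑ S, sgn P Q R S T * f P Q R S =
      ∑ p, ∑ q, ∑ r, ∑ s, epsUp p q r s * f (line T p) (line T q) (line T r) (line T s) := by
  rw [sum_line T (by simp [sgn_eq_zero])]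
  refine Finset.sum_congr rfl fun p _ => ?_
  rw [sum_line T (by simp [sgn_eq_zero])]
  refine Finset.sum_congr rfl fun q _ => ?_
  rw [sum_line T (by simp [sgn_eq_zero])]
  refine Finset.sum_congr rfl fun r _ => ?_
  rw [sum_line T (by simp [sgn_eq_zero])]
  simp only [sgn_line]

namespace BField

variable {N : Type*} (B : BField N)

/-- The components of the field on the wedges of the corner cell `c_T`. -/
def corner (ν : N) (T : Fin 5) (p q : Fin 4) : Matrix (Fin 4) (Fin 4) ℝ :=
  upper (B.val ν (line T p) (line T q))

theorem corner_transpose (ν : N) (T : Fin 5) (p q : Fin 4) :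
    (B.corner ν T p q)ᵀ = -B.corner ν T p q := upper_transpose _

theorem upper_antisymm (ν : N) (P Q : Fin 5) : upper (B.val ν Q P) = -upper (B.val ν P Q) := by
  rw [B.antisymm ν P Q, upper, upper, NegMemClass.coe_neg, neg_mul]

theorem corner_antisymm (ν : N) (T : Fin 5) (p q : Fin 4) :
    B.corner ν T q p = -B.corner ν T p q := B.upper_antisymm _ _ _

theorem upper_self (ν : N) (P : Fin 5) : upper (B.val ν P P) = 0 := by
  have := B.upper_antisymm ν P P
  rwa [eq_neg_iff_add_eq_zero, ← two_smul ℝ, smul_eq_zero_iff_right two_ne_zero] at this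

theorem urbantke_line (ν : N) (T : Fin 5) (q r : Fin 4) :
    B.urbantke ν T (lineEquiv T q) (lineEquiv T r) =
      4 / (12 * B.volume ν T) * cubicForm (B.corner ν T) q r := by
  have h : ∀ i, ((lineEquiv T i : {P : Fin 5 // P ≠ T}) : Fin 5) = line T i := fun _ => rfl
  rw [urbantke, sum_sgn_line T fun A B' C D => structureForm (B.val ν (lineEquiv T q) A)
    (B.val ν B' C) (B.val ν D (lineEquiv T r))]
  simp only [h, structureForm_eq, cubicForm, Finset.mul_sum, tripleTrace, corner]
  refine Finset.sum_congr rfl fun a _ => Finset.sum_congr rfl fun b _ =>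
    Finset.sum_congr rfl fun c _ => Finset.sum_congr rfl fun d _ => ?_
  ring

/-- The form of Urbantke type of a field `± ∗ e ∧ e` is `± 4 det(e) / V` times the metric. -/
theorem urbantke_of_hodge {ν : N} {T : Fin 5} {e : Fin 4 → Mink} {s : ℝ}
    (h : ∀ p q, B.corner ν T p q = s • hodge (wedge (e p) (e q))) (q r : Fin 4) :
    B.urbantke ν T (lineEquiv T q) (lineEquiv T r) =
      4 / B.volume ν T * s ^ 3 * Matrix.det (Matrix.of e) * (e q ⬝ᵥ eta *ᵥ e r) := by
  have : B.corner ν T = fun p q => s • hodge (wedge (e p) (e q)) := by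
    funext p q; exact h p q
  rw [urbantke_line, this, cubicForm_smul, cubicForm_hodge]
  by_cases hV : B.volume ν T = 0
  · simp [hV]
  · field_simp

theorem urbantke_of_wedge {ν : N} {T : Fin 5} {e : Fin 4 → Mink} {s : ℝ}
    (h : ∀ p q, B.corner ν T p q = s • wedge (e p) (e q)) : B.urbantke ν T = 0 := by
  have : B.corner ν T = fun p q => s • wedge (e p) (e q) := by
    funext p q; exact h p q
  ext Q R
  obtain ⟨q, rfl⟩ := (lineEquiv T).surjective Q
  obtain ⟨r, rfl⟩ := (lineEquiv T).surjective R
  rw [urbantke_line, this, cubicForm_smul, cubicForm_wedge]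
  simp

theorem cornerSum_line (ν : N) (T : Fin 5) : B.cornerSum ν T =
    1 / 2 * ∑ p, ∑ q, ∑ r, ∑ s, epsUp p q r s *
      epsPair (B.val ν (line T p) (line T q)) (B.val ν (line T r) (line T s)) := by
  rw [cornerSum, sum_sgn_line T fun P Q R S => epsPair (B.val ν P Q) (B.val ν R S)]

/-- A positive multiple of the Gram matrix of a frame is equivalent to the Minkowski metric. -/
theorem equivalent_of_hodge {ν : N} {T : Fin 5} {e : Fin 4 → Mink} (hV : 0 < B.volume ν T)
    (he : 0 < Matrix.det (Matrix.of e)) {M : Matrix {P : Fin 5 // P ≠ T} {P : Fin 5 // P ≠ T} ℝ}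
    (hM : ∀ q r, M (lineEquiv T q) (lineEquiv T r) =
      4 / B.volume ν T * Matrix.det (Matrix.of e) * (e q ⬝ᵥ eta *ᵥ e r)) :
    QuadraticMap.Equivalent M.toQuadraticForm' eta.toQuadraticForm' := by
  set k := 4 / B.volume ν T * Matrix.det (Matrix.of e) with hk
  have hk0 : 0 < k := by positivity
  refine equivalent_of_congruent (lineEquiv T) (E := √k • Matrix.of e) ?_ fun q r => ?_
  · rw [Matrix.det_smul]
    exact mul_ne_zero (pow_ne_zero _ (Real.sqrt_pos.2 hk0).ne') he.ne'
  · rw [hM, Matrix.transpose_smul, Matrix.smul_mul, Matrix.smul_mul, Matrix.mul_smul, smul_smul,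
      Real.mul_self_sqrt hk0.le, Matrix.smul_apply, smul_eq_mul, mul_assoc]
    rw [Matrix.mul_mul_apply, Matrix.transpose_transpose, hk, mul_assoc]
    rfl

theorem sum_epsUp_sq : ∑ p, ∑ q, ∑ r, ∑ s, epsUp p q r s * epsUp p q r s = 24 := by
  have : ∑ p : Fin 4, ∑ q : Fin 4, ∑ r : Fin 4, ∑ s : Fin 4,
      epsilon ![p, q, r, s] * epsilon ![p, q, r, s] = 24 := by decide +kernel
  simp only [epsUp]
  exact_mod_cast this

/-! ### From an oriented tetrad to the three conditions -/

section Converse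

variable {B} {e : Tetrad N}

theorem IsGeometric.upper_eq (h : B.IsGeometric e) (ν : N) (P Q : Fin 5) :
    upper (B.val ν P Q) = hodge (wedge (e ν P) (e ν Q)) := by
  by_cases hPQ : P = Q
  · subst hPQ
    rw [upper_self, wedge_self, ← zero_smul ℝ (0 : Matrix (Fin 4) (Fin 4) ℝ), hodge_smul, zero_smul,
      zero_smul]
  · exact h ν P Q hPQ

theorem IsGeometric.epsPair_eq (h : B.IsGeometric e) (ν : N) (P Q R S : Fin 5) :
    epsPair (B.val ν P Q) (B.val ν R S) =
      4 * Matrix.det (Matrix.of ![e ν P, e ν Q, e ν R, e ν S]) := by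
  rw [DiscreteGravity.epsPair_eq, h.upper_eq, h.upper_eq,
    wedgePair_hodge (wedge_transpose _ _) (wedge_transpose _ _), det_eq]
  ring

theorem IsGeometric.epsPair_line (h : B.IsGeometric e) (ν : N) (T : Fin 5) (p q r s : Fin 4) :
    epsPair (B.val ν (line T p) (line T q)) (B.val ν (line T r) (line T s)) =
      4 * Matrix.det (Matrix.of fun i => e ν (line T i)) * epsUp p q r s := by
  rw [h.epsPair_eq, det_frame (fun i => e ν (line T i)), mul_assoc]

theorem IsGeometric.cornerSum_eq (h : B.IsGeometric e) (ν : N) (T : Fin 5) :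
    B.cornerSum ν T = 48 * Matrix.det (Matrix.of fun i => e ν (line T i)) := by
  have : ∀ p q r s, epsUp p q r s *
      epsPair (B.val ν (line T p) (line T q)) (B.val ν (line T r) (line T s)) =
      4 * Matrix.det (Matrix.of fun i => e ν (line T i)) * (epsUp p q r s * epsUp p q r s) := by
    intro p q r s
    rw [h.epsPair_line]; ring
  rw [cornerSum_line]
  simp only [this, ← Finset.mul_sum, sum_epsUp_sq]
  ring

theorem det_line_pos (he : e.Oriented) (ν : N) (T : Fin 5) :
    0 < Matrix.det (Matrix.of fun i => e ν (line T i)) := by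
  have h1 : epsUp 0 1 2 3 = 1 := by
    rw [epsUp, show epsilon ![(0 : Fin 4), 1, 2, 3] = 1 by decide, Int.cast_one]
  have := he ν (line T 0) (line T 1) (line T 2) (line T 3) T
    (by rw [sgn_line, h1]; exact one_ne_zero)
  rwa [sgn_line, h1, one_mul, det_frame (fun i => e ν (line T i)), h1, mul_one] at this

theorem IsGeometric.GG1 (h : B.IsGeometric e) : B.GG1 := by
  intro ν T P Q R S hP hQ hR hS _ _
  obtain ⟨p, rfl⟩ := exists_line hP
  obtain ⟨q, rfl⟩ := exists_line hQ
  obtain ⟨r, rfl⟩ := exists_line hR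
  obtain ⟨s, rfl⟩ := exists_line hS
  rw [h.epsPair_line, h.cornerSum_eq, sgn_line]
  ring

theorem IsGeometric.GG2 (h : B.IsGeometric e) (he : e.Oriented) : B.GG2 := by
  intro ν T
  have := det_line_pos he ν T
  rw [volume, h.cornerSum_eq]
  positivity

theorem IsGeometric.GG3 (h : B.IsGeometric e) (he : e.Oriented) : B.GG3 := by
  intro ν T
  have := B.equivalent_of_hodge (h.GG2 he ν T) (det_line_pos he ν T)
    (M := B.urbantke ν T) fun q r => by
      rw [B.urbantke_of_hodge (e := fun i => e ν (line T i)) (s := 1)]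
      · ring
      · intro p q
        rw [one_smul]
        exact h.upper_eq ν _ _
  exact ⟨this.sigPos_eq, this.sigNeg_eq⟩

end Converse

/-! ### From the three conditions to a tetrad on a corner cell -/

/-- The three conditions in a corner cell produce a tetrad on the lines of the cell. -/
theorem exists_corner_tetrad (h1 : B.GG1) (h2 : B.GG2) (h3 : B.GG3) (ν : N) (T : Fin 5) :
    ∃ e : Fin 4 → Mink, 0 < Matrix.det (Matrix.of e) ∧
      ∀ p q, B.corner ν T p q = hodge (wedge (e p) (e q)) := by
  have hV := h2 ν T
  have hc : 0 < B.cornerSum ν T := by rw [volume] at hV; linarith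
  -- The factor combines the mean over 12 pairs with the -4 of `epsPair_eq`. Diagonal indices lie
  -- outside (GG1), and there both sides vanish.
  have hrel : ∀ p q r s, wedgePair (B.corner ν T p q) (B.corner ν T r s) =
      -(B.cornerSum ν T / 48) * epsUp p q r s := by
    intro p q r s
    by_cases hpq : p = q
    · subst hpq
      rw [← sgn_line T, sgn_eq_zero (by simp), mul_zero, corner, upper_self]
      simp [wedgePair]
    by_cases hrs : r = s
    · subst hrs
      rw [← sgn_line T, sgn_eq_zero (by simp), mul_zero, corner, corner, upper_self]
      simp [wedgePair]
    have := h1 ν T (line T p) (line T q) (line T r) (line T s) (line_ne T p) (line_ne T q)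
      (line_ne T r) (line_ne T s) ((line_injective T).ne hpq) ((line_injective T).ne hrs)
    rw [DiscreteGravity.epsPair_eq, sgn_line] at this
    rw [corner, corner]
    linarith
  obtain ⟨s, e, hs, h | h⟩ := exists_frame_or_hodge (by linarith) (B.corner_transpose ν T)
    (B.corner_antisymm ν T) hrel
  · exfalso
    have := (h3 ν T).1
    rw [B.urbantke_of_wedge h, sigPos_zero_matrix, sig_eta.1] at this
    omega
  have hss : s * s = 1 := by rcases hs with rfl | rfl <;> norm_num
  have hdet : 0 < Matrix.det (Matrix.of e) := by
    have h1 : epsUp 0 1 2 3 = 1 := by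
      rw [epsUp, show epsilon ![(0 : Fin 4), 1, 2, 3] = 1 by decide, Int.cast_one]
    have h2 := det_frame e 0 1 2 3
    rw [h1, mul_one, det_eq] at h2
    have h3 := hrel 0 1 2 3
    rw [h, h, wedgePair_smul_left, wedgePair_comm, wedgePair_smul_left, wedgePair_comm, ← mul_assoc,
      hss, one_mul, wedgePair_hodge (wedge_transpose _ _) (wedge_transpose _ _), h1] at h3
    linarith
  rcases hs with rfl | rfl
  · exact ⟨e, hdet, fun p q => by rw [h, one_smul]⟩
  -- With the wrong sign, minus the Urbantke form is a positive multiple of the Gram matrix, so the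
  -- form itself would have signature (1,3) instead of (3,1).
  · exfalso
    have key := B.equivalent_of_hodge hV hdet (M := -B.urbantke ν T) fun q r => by
      rw [Matrix.neg_apply, B.urbantke_of_hodge h]
      ring
    have hneg : (-B.urbantke ν T).toQuadraticForm' = -(B.urbantke ν T).toQuadraticForm' := by
      ext x
      rw [neg_apply, toQuadraticForm'_apply, toQuadraticForm'_apply,
        Matrix.neg_mulVec, dotProduct_neg]
    rw [hneg] at key
    have := key.sigNeg_eq
    rw [sigNeg_neg, (h3 ν T).1, sig_eta.1, sig_eta.2] at this
    omega

/-- A frame on the lines of each corner cell, extended by zero. -/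
theorem exists_extended_corner_tetrad (h1 : B.GG1) (h2 : B.GG2) (h3 : B.GG3) (ν : N) (T : Fin 5) :
    ∃ e : Fin 5 → Mink, 0 < Matrix.det (Matrix.of fun i => e (line T i)) ∧
      ∀ P Q, P ≠ T → Q ≠ T → upper (B.val ν P Q) = hodge (wedge (e P) (e Q)) := by
  obtain ⟨e, he, h⟩ := B.exists_corner_tetrad h1 h2 h3 ν T
  have hinv : ∀ i, Function.extend (line T) e 0 (line T i) = e i := fun i =>
    (line_injective T).extend_apply e 0 i
  refine ⟨Function.extend (line T) e 0, by simpa only [hinv] using he, fun P Q hP hQ => ?_⟩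
  obtain ⟨p, rfl⟩ := exists_line hP
  obtain ⟨q, rfl⟩ := exists_line hQ
  rw [hinv, hinv, ← h]
  rfl

end BField

/-! ### Rigidity and gluing of corner cells -/

theorem hodge_injective {W V : Matrix (Fin 4) (Fin 4) ℝ} (hW : Wᵀ = -W) (hV : Vᵀ = -V)
    (h : hodge W = hodge V) : W = V := by
  rw [← neg_inj, ← hodge_hodge hW, ← hodge_hodge hV, h]

/-- Two tetrads with the same bivectors on three lines of a corner cell agree there up to sign. -/
theorem tetrad_rigid {T P Q R : Fin 5} (hP : P ≠ T) (hQ : Q ≠ T) (hR : R ≠ T) (hPQ : P ≠ Q)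
    (hPR : P ≠ R) (hQR : Q ≠ R) {u x : Fin 5 → Mink}
    (hu : Matrix.det (Matrix.of fun i => u (line T i)) ≠ 0)
    (h1 : hodge (wedge (x P) (x Q)) = hodge (wedge (u P) (u Q)))
    (h2 : hodge (wedge (x P) (x R)) = hodge (wedge (u P) (u R)))
    (h3 : hodge (wedge (x Q) (x R)) = hodge (wedge (u Q) (u R))) :
    ∃ s : ℝ, (s = 1 ∨ s = -1) ∧ x P = s • u P ∧ x Q = s • u Q ∧ x R = s • u R := by
  obtain ⟨p, rfl⟩ := exists_line hP
  obtain ⟨q, rfl⟩ := exists_line hQ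
  obtain ⟨r, rfl⟩ := exists_line hR
  exact eq_or_eq_neg_of_wedge_eq hu (fun h => hPQ (congrArg _ h)) (fun h => hPR (congrArg _ h))
    (fun h => hQR (congrArg _ h))
    (hodge_injective (wedge_transpose _ _) (wedge_transpose _ _) h1)
    (hodge_injective (wedge_transpose _ _) (wedge_transpose _ _) h2)
    (hodge_injective (wedge_transpose _ _) (wedge_transpose _ _) h3)

theorem ne_zero_of_det_ne_zero {T P : Fin 5} (hP : P ≠ T) {u : Fin 5 → Mink}
    (hu : Matrix.det (Matrix.of fun i => u (line T i)) ≠ 0) : u P ≠ 0 := by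
  obtain ⟨p, rfl⟩ := exists_line hP
  intro h
  exact hu (Matrix.det_eq_zero_of_row_eq_zero p fun j => congrFun h j)

/-- Two tetrads with the same bivectors on the lines common to two corner cells agree there up to
sign. -/
theorem exists_sign {T U : Fin 5} (hTU : T ≠ U) {u x : Fin 5 → Mink}
    (hu : Matrix.det (Matrix.of fun i => u (line T i)) ≠ 0)
    (h : ∀ P Q, P ≠ T → P ≠ U → Q ≠ T → Q ≠ U →
      hodge (wedge (x P) (x Q)) = hodge (wedge (u P) (u Q))) :
    ∃ s : ℝ, (s = 1 ∨ s = -1) ∧ ∀ P, P ≠ T → P ≠ U → x P = s • u P := by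
  have : ∀ T U : Fin 5, T ≠ U → ∃ P Q R : Fin 5, P ≠ T ∧ P ≠ U ∧ Q ≠ T ∧ Q ≠ U ∧ R ≠ T ∧ R ≠ U ∧
      P ≠ Q ∧ P ≠ R ∧ Q ≠ R ∧ ∀ X, X ≠ T → X ≠ U → X = P ∨ X = Q ∨ X = R := by decide
  obtain ⟨P, Q, R, hP, hP', hQ, hQ', hR, hR', hPQ, hPR, hQR, all⟩ := this T U hTU
  obtain ⟨s, hs, h1, h2, h3⟩ := tetrad_rigid hP hQ hR hPQ hPR hQR hu (h _ _ hP hP' hQ hQ')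
    (h _ _ hP hP' hR hR') (h _ _ hQ hQ' hR hR')
  refine ⟨s, hs, fun X hX hX' => ?_⟩
  rcases all X hX hX' with rfl | rfl | rfl <;> assumption

/-- Tetrads with the same bivectors agree up to sign if one of them is nondegenerate. -/
theorem eq_or_eq_neg_of_hodge_eq {u x : Fin 5 → Mink}
    (hu : ∀ T, Matrix.det (Matrix.of fun i => u (line T i)) ≠ 0)
    (h : ∀ P Q, hodge (wedge (x P) (x Q)) = hodge (wedge (u P) (u Q))) : x = u ∨ x = -u := by
  obtain ⟨s, hs, hx⟩ := exists_sign (T := 3) (U := 4) (by decide) (hu 3) fun P Q _ _ _ _ => h P Q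
  -- Every line lies in a triple shared by two cells that meets the reference triple in some `Q`;
  -- since `u Q ≠ 0`, the two signs agree.
  have : ∀ P : Fin 5, ∃ T U Q : Fin 5, T ≠ U ∧ P ≠ T ∧ P ≠ U ∧ Q ≠ T ∧ Q ≠ U ∧ Q ≠ 3 ∧ Q ≠ 4 := by
    decide
  have key : ∀ P, x P = s • u P := by
    intro P
    obtain ⟨T, U, Q, hTU, hPT, hPU, hQT, hQU, hQ3, hQ4⟩ := this P
    obtain ⟨t, -, hx'⟩ := exists_sign hTU (hu T) fun P Q _ _ _ _ => h P Q
    have : s = t := smul_left_injective ℝ (ne_zero_of_det_ne_zero hQT (hu T))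
      ((hx Q hQ3 hQ4).symm.trans (hx' Q hQT hQU))
    rw [hx' P hPT hPU, this]
  rcases hs with rfl | rfl
  · left; funext P; rw [key, one_smul]
  · right; funext P; rw [key, neg_one_smul]; rfl

/-- Nondegenerate tetrads on the corner cells of a 4-simplex, inducing the same bivectors, come
from one tetrad on the 4-simplex. -/
theorem exists_glued_tetrad {b : Fin 5 → Fin 5 → Matrix (Fin 4) (Fin 4) ℝ}
    (E : Fin 5 → Fin 5 → Mink)
    (hE : ∀ T, Matrix.det (Matrix.of fun i => E T (line T i)) ≠ 0)
    (hb : ∀ T P Q, P ≠ T → Q ≠ T → b P Q = hodge (wedge (E T P) (E T Q))) :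
    ∃ e : Fin 5 → Mink, ∀ P Q, b P Q = hodge (wedge (e P) (e Q)) := by
  have agree : ∀ T, ∃ s : ℝ, (s = 1 ∨ s = -1) ∧
      ∀ P, P ≠ 0 → P ≠ T → s • E T P = E 0 P := by
    intro T
    by_cases hT : T = 0
    · exact ⟨1, .inl rfl, fun P _ _ => by rw [hT, one_smul]⟩
    · obtain ⟨s, hs, h⟩ := exists_sign (fun h => hT h.symm) (hE 0) (x := E T) (U := T)
        fun P Q hP hP' hQ hQ' => by rw [← hb T P Q hP' hQ', ← hb 0 P Q hP hQ]
      refine ⟨s, hs, fun P hP hP' => ?_⟩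
      rw [h P hP hP', smul_smul]
      rcases hs with rfl | rfl <;> norm_num
  choose s hs hagree using agree
  set F : Fin 5 → Fin 5 → Mink := fun T P => s T • E T P with hF
  have hbF : ∀ T P Q, P ≠ T → Q ≠ T → b P Q = hodge (wedge (F T P) (F T Q)) := by
    intro T P Q hP hQ
    rw [hb T P Q hP hQ, hF]
    simp only [wedge_smul_left, wedge_smul_right, smul_smul]
    rcases hs T with h | h <;> norm_num [h]
  have hF0 : ∀ T, T ≠ 0 → T ≠ 1 → F T 0 = F 1 0 := by
    intro T hT0 hT1
    have hdet : Matrix.det (Matrix.of fun i => F 1 (line 1 i)) ≠ 0 := by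
      rw [show (Matrix.of fun i => F 1 (line 1 i)) =
        s 1 • Matrix.of fun i => E 1 (line 1 i) from rfl, Matrix.det_smul]
      refine mul_ne_zero (pow_ne_zero _ ?_) (hE 1)
      rcases hs 1 with h | h <;> norm_num [h]
    obtain ⟨t, -, h⟩ := exists_sign hT1.symm hdet (x := F T) fun P Q hP hP' hQ hQ' => by
      rw [← hbF T P Q hP' hQ', ← hbF 1 P Q hP hQ]
    obtain ⟨Q, hQ0, hQ1, hQT⟩ : ∃ Q : Fin 5, Q ≠ 0 ∧ Q ≠ 1 ∧ Q ≠ T := by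
      have : ∀ T : Fin 5, ∃ Q : Fin 5, Q ≠ 0 ∧ Q ≠ 1 ∧ Q ≠ T := by decide
      exact this T
    have ht : t = 1 := by
      refine smul_left_injective ℝ (ne_zero_of_det_ne_zero hQ1 hdet) ?_
      change t • F 1 Q = (1 : ℝ) • F 1 Q
      rw [← h Q hQ1 hQT, one_smul]
      exact (hagree T Q hQ0 hQT).trans (hagree 1 Q hQ0 hQ1).symm
    rw [h 0 (by decide) hT0.symm, ht, one_smul]
  refine ⟨fun P => if P = 0 then F 1 0 else E 0 P, fun P Q => ?_⟩
  have local_eq : ∀ T P, P ≠ T → (if P = 0 then F 1 0 else E 0 P) = F T P := by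
    intro T P hP
    split_ifs with h
    · subst h
      by_cases hT : T = 1
      · rw [hT]
      · exact (hF0 T hP.symm hT).symm
    · exact (hagree T P h hP).symm
  obtain ⟨T, hP, hQ⟩ : ∃ T : Fin 5, P ≠ T ∧ Q ≠ T := by
    revert P Q; decide
  simp only [local_eq T P hP, local_eq T Q hQ]
  exact hbF T P Q hP hQ

end DiscreteGravity

end

/-! ### The theorem -/

open DiscreteGravity in
theorem mainTheorem3 {N : Type*} (B : BField N) (hB : B.Nondegenerate) :
    (∃ e : Tetrad N, e.Oriented ∧ B.IsGeometric e ∧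
      ∀ e' : Tetrad N, B.IsGeometric e' → ∀ ν, e' ν = e ν ∨ e' ν = -e ν) ↔
    (B.GG1 ∧ B.GG2 ∧ B.GG3) := by
  constructor
  · rintro ⟨e, he, hg, -⟩
    exact ⟨hg.GG1, hg.GG2 he, hg.GG3 he⟩
  rintro ⟨h1, h2, h3⟩
  have glue : ∀ ν, ∃ e : Fin 5 → Mink, ∀ P Q, upper (B.val ν P Q) = hodge (wedge (e P) (e Q)) := by
    intro ν
    choose E hE hb using B.exists_extended_corner_tetrad h1 h2 h3 ν
    exact exists_glued_tetrad E (fun T => (hE T).ne') hb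
  choose e he using glue
  have hg : B.IsGeometric e := fun ν P Q _ => he ν P Q
  have ho : Tetrad.Oriented e := by
    intro ν P Q R S T hs
    have hne : ¬(P = T ∨ Q = T ∨ R = T ∨ S = T ∨ P = Q ∨ R = S) := fun h => hs (sgn_eq_zero h)
    push Not at hne
    obtain ⟨hP, hQ, hR, hS, hPQ, hRS⟩ := hne
    have h := h1 ν T P Q R S hP hQ hR hS hPQ hRS
    have hV := h2 ν T
    rw [BField.volume] at hV
    rw [hg.epsPair_eq] at h
    have hsq : 0 < sgn P Q R S T * sgn P Q R S T := mul_self_pos.2 hs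
    have : 0 < sgn P Q R S T * sgn P Q R S T * B.cornerSum ν T := mul_pos hsq (by linarith)
    -- (GG1) together with `⟨B, B⟩ = 4 det` expresses the determinant as `sgn · Σ / 48`, so its
    -- product with the sign is positive by (GG2).
    calc (0 : ℝ) < 1 / 48 * (sgn P Q R S T * sgn P Q R S T * B.cornerSum ν T) := by positivity
      _ = sgn P Q R S T * (1 / 48 * sgn P Q R S T * B.cornerSum ν T) := by ring
      _ = _ := by congr 1; linarith
  refine ⟨e, ho, hg, fun e' hg' ν => ?_⟩
  exact eq_or_eq_neg_of_hodge_eq (fun T => (BField.det_line_pos ho ν T).ne')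
    fun P Q => by rw [← hg'.upper_eq, ← hg.upper_eq]
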